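/- **Setting.** Prototiles. Let $\mathcal P$ be a finite set of prototiles: labelled compact sets $\operatorname{supp}(p)\subset\mathbb R^2$, each equal to the closure of its interior and containing the origin in its interior. A tile is a translate $t=q+x$ ($q\in\mathcal P$, $x\in\mathbb R^2$) and its puncture is $x(t)=x$. A tiling is a countable collection of tiles with pairwise disjoint interiors covering $\mathbb R^2$; a patch is a finite collection of tiles of a tiling whose support has connected interior. Substitution. Let $\omega$ be a substitution rule on $\mathcal P$ with scaling factor $\lambda>1$: each $\omega(p)$ is a patch of tiles with pairwise disjoint interiors and union $\lambda\operatorname{supp}(p)$, and $\omega(p+x)=\omega(p)+\lambda x$. Assume that $\omega$ is primitive, that $p\in\omega(p)$ for all $p$, and that the tilings $T_p=\bigcup_n\omega^n(p)$ have no nonzero period. For $n\ge 1$ put $D^{(n)}_{pq}=\{x: q+x\in\omega^n(p)\}$. Quasi-dual trees. A consistent family of quasi-dual trees is a family $G=(G_p)_{p\in\mathcal P}$ of finite trees, where $G_p\subset\operatorname{supp}(p)$ has arcs as edges, any two of which meet at most in common endpoints, $G_p$ meets $\partial\operatorname{supp}(p)$ only in vertices, all of degree one, the puncture $0$ is a vertex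 of $G_p$, and, when $G$ is copied into every tile of a tiling $T_q$, a boundary vertex of a tile that lies in another tile is also a vertex of the copy in that other tile. (A dual tree, i.e. a star joining the puncture to one interior point of each edge of $p$, is a special case.) Recurrent pair. Let $(G,S)$ be a recurrent pair of such families: for some $N\ge1$ there are homeomorphisms $\psi:G_p\to S_p$ taking edges onto edges such that, with $D^E_{ef}=\{x\in D^{(N)}_{pq}:\lambda^{-N}(f+x)\subseteq\psi(e)\}$ for edges $e$ of $G_p$ and $f$ of $G_q$, each $\psi(e)$ is the union of the sets $\lambda^{-N}(f+x)$, $x\in D^E_{ef}$. Suppose that the matrix $M^E=(|D^E_{ef}|)$ is primitive, with Perron–Frobenius eigenvalue $\kappa>1$ and positive eigenvector $v$, $M^Ev=\kappa v$. Let $A$ be the attractor, $A_e=\bigcup_f\lambda^{-N}(A_f+D^E_{ef})$, and assume that the sets $A_e$ are the edges of a consistent family of quasi-dual trees $A=(A_p)_p$. The edge $A_e$ and its translates have length $v_e$. Fractal tree. For $B=(B_p)_p$ let $\mathcal R^N(B)_p=\bigcup_q\lambda^{-N}(B_q+D^{(N)}_{pq})$; the edges of $\mathcal R^N(A)_p$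 are the sets $\lambda^{-N}(A_f+x)$ with $x\in D^{(N)}_{pq}$, $f$ an edge of $G_q$. Let $F_1$ be a subgraph of $\mathcal R^N(A)$ such that, for every $p$, $(F_1)_p$ is a connected tree contained in the interior of $\operatorname{supp}(p)$, has $\lambda^{-N}x(t)$ as a vertex for every $t\in\omega^N(p)$, and contains every edge of $\mathcal R^N(A)_p$ that is contained in $A_p$ and has no endpoint on $\partial\operatorname{supp}(p)$. Put $F_{n+1}=\mathcal R^N(F_n)\cup F_n$. Fix $p\in\mathcal P$ and let $\mathfrak F_p=\bigcup_{n\ge1}\lambda^{Nn}(F_n)_p$ be a fractal tree on $T_p$; that is, this graph, whose edges are the translates $A_f+x\subseteq\mathfrak F_p$ of edges of $A$ in the tiles of $T_p$, is a connected tree having the punctures of all tiles of $T_p$ as vertices. The fractal distance $d_{\mathfrak F_p}(t,t')$ of $t,t'\in T_p$ is the sum of the lengths of the edges on the unique path in $\mathfrak F_p$ from $x(t)$ to $x(t')$. Operators. Let $\Omega_{punc}$ be the discrete hull of $\omega$: the tilings that are limits, in the tiling metric, of translates of the tilings $T_q$ and that have a tile with puncture at the origin. For tiles $t,t'$ of a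 patch $P$ let $e(P,t,t')(T,T')=1$ if $T\in\Omega_{punc}$, $P-x(t)\subseteq T$ and $T'=T-(x(t')-x(t))$, and $e(P,t,t')(T,T')=0$ otherwise. Let $H_p=\ell^2(T_p\setminus\{p\})$, let $$(\pi_p(f)\xi)(s)=\sum_{s'\in T_p\setminus\{p\}}f(T_p-x(s),T_p-x(s'))\,\xi(s'),$$ and let $D_p$ be the self-adjoint operator $D_p\delta_s=\ln\big(d_{\mathfrak F_p}(s,p)\big)\delta_s$ on $H_p$, with domain $\{\xi:\sum_s|\ln(d_{\mathfrak F_p}(s,p))\,\xi(s)|^2<\infty\}$. **Proposition.** Let $P$ be a patch in a tiling $T\in\Omega_{punc}$. Then, for all $t,t'\in P$, the operator $\pi_p(e(P,t,t'))$ is bounded on $H_p$ and maps the domain of $D_p$ into itself, and $$[D_p,\pi_p(e(P,t,t'))]=D_p\,\pi_p(e(P,t,t'))-\pi_p(e(P,t,t'))\,D_p$$ extends to a bounded operator on $H_p$. -/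

import Mathlib

open Set
open scoped Pointwise ENNReal

noncomputable section

namespace FractalTiling

/-- The Euclidean plane. -/
abbrev Plane := EuclideanSpace ℝ (Fin 2)

/-! ### Tiles and tilings -/

/-- A family of prototiles, indexed by their labels `p : ι`: compact sets that are the closure
of their interior.  The puncture of every prototile is the origin, which lies in the interior. -/
structure PrototileSet (ι : Type*) where
  supp : ι → Set Plane
  isCompact_supp : ∀ p, IsCompact (supp p)
  closure_interior_supp : ∀ p, closure (interior (supp p)) = supp p
  zero_mem_interior : ∀ p, (0 : Plane) ∈ interior (supp p)

/-- The tile `label + pos`, a translate of a prototile.  Since the puncture of a prototile is the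
origin, the puncture `x(t)` of the tile `t` is `t.pos`. -/
@[ext] structure Tile (ι : Type*) where
  label : ι
  pos : Plane

/-- The prototile `p`, as a tile. -/
def Tile.ofProto {ι : Type*} (p : ι) : Tile ι := ⟨p, 0⟩

/-- The translate `t + x` of a tile. -/
def Tile.shift {ι : Type*} (t : Tile ι) (x : Plane) : Tile ι := ⟨t.label, t.pos + x⟩

/-- The translate `T + x` of a collection of tiles. -/
def shiftSet {ι : Type*} (T : Set (Tile ι)) (x : Plane) : Set (Tile ι) :=
  (fun t => t.shift x) '' T

namespace PrototileSet

variable {ι : Type*} (Pr : PrototileSet ι)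

/-- The support of a tile. -/
def tileSupp (t : Tile ι) : Set Plane := t.pos +ᵥ Pr.supp t.label

/-- The support of a collection of tiles. -/
def suppOf (P : Set (Tile ι)) : Set Plane := ⋃ t ∈ P, Pr.tileSupp t

/-- Distinct tiles of the collection have disjoint interiors. -/
def NonOverlapping (P : Set (Tile ι)) : Prop :=
  ∀ t ∈ P, ∀ t' ∈ P, t ≠ t' →
    interior (Pr.tileSupp t) ∩ interior (Pr.tileSupp t') = ∅

/-- `T` is a tiling of the plane. -/
structure IsTiling (T : Set (Tile ι)) : Prop where
  countable : T.Countable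
  covers : Pr.suppOf T = univ
  nonOverlapping : Pr.NonOverlapping T

/-- A finite collection of tiles whose support has connected interior. -/
structure IsPatch (P : Set (Tile ι)) : Prop where
  finite : P.Finite
  nonOverlapping : Pr.NonOverlapping P
  isConnected : IsConnected (interior (Pr.suppOf P))

/-- `T ⊓ B(0,r)`: the tiles of `T` contained in the ball of radius `r` about the origin. -/
def within (T : Set (Tile ι)) (r : ℝ) : Set (Tile ι) :=
  {t ∈ T | Pr.tileSupp t ⊆ Metric.ball 0 r}

/-- The tiling metric. -/
def tilingDist (T₁ T₂ : Set (Tile ι)) : ℝ :=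
  sInf ({ε : ℝ | 0 < ε ∧ ∃ x₁ x₂ : Plane, ‖x₁‖ < ε ∧ ‖x₂‖ < ε ∧
    Pr.within (shiftSet T₁ (-x₁)) ε⁻¹ = Pr.within (shiftSet T₂ (-x₂)) ε⁻¹} ∪ {1})

/-- The continuous hull of `T`: the completion of the orbit of `T` in the tiling metric, realised
as the set of all tilings that are limits of translates of `T` in the tiling metric. -/
def hull (T : Set (Tile ι)) : Set (Set (Tile ι)) :=
  {T' | Pr.IsTiling T' ∧ ∀ δ > 0, ∃ x : Plane, Pr.tilingDist T' (shiftSet T x) < δ}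

/-- The discrete hull of `T`: the tilings in the hull having a tile with puncture at the origin. -/
def discreteHull (T : Set (Tile ι)) : Set (Set (Tile ι)) :=
  {T' ∈ Pr.hull T | ∃ t ∈ T', t.pos = 0}

end PrototileSet

/-- A tiling is nonperiodic if it has no nonzero translational period. -/
def Nonperiodic {ι : Type*} (T : Set (Tile ι)) : Prop := ∀ x : Plane, shiftSet T x = T → x = 0

/-! ### Substitution rules -/

/-- A substitution rule `ω` with scaling factor `lam > 1`: `ω(p) = rule p` is a patch that tiles
`lam • supp p`. -/
structure Substitution {ι : Type*} (Pr : PrototileSet ι) where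
  lam : ℝ
  one_lt_lam : 1 < lam
  rule : ι → Set (Tile ι)
  isPatch_rule : ∀ p, Pr.IsPatch (rule p)
  suppOf_rule : ∀ p, Pr.suppOf (rule p) = lam • Pr.supp p

namespace Substitution

variable {ι : Type*} {Pr : PrototileSet ι} (σ : Substitution Pr)

/-- `ω(p + x) = ω(p) + lam • x`. -/
def onTile (t : Tile ι) : Set (Tile ι) := shiftSet (σ.rule t.label) (σ.lam • t.pos)

/-- `ω(T) = ⋃ t ∈ T, ω(t)`. -/
def onSet (T : Set (Tile ι)) : Set (Tile ι) := ⋃ t ∈ T, σ.onTile t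

/-- The supertile `ωⁿ(p)`. -/
def iter (n : ℕ) (p : ι) : Set (Tile ι) := σ.onSet^[n] {Tile.ofProto p}

/-- The tiling `T_p = ⋃ n, ωⁿ(p)` generated by `p`. -/
def tiling (p : ι) : Set (Tile ι) := ⋃ n, σ.iter n p

/-- The `(p,q)` entry of the digit matrix of `ωⁿ`: all `x` with `q + x ∈ ωⁿ(p)`. -/
def digits (n : ℕ) (p q : ι) : Set Plane := {x | (⟨q, x⟩ : Tile ι) ∈ σ.iter n p}

/-- The substitution matrix of `ω`. -/
def substMatrix : Matrix ι ι ℝ := Matrix.of fun p q => ((σ.digits 1 p q).ncard : ℝ)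

/-- `ω` is a primitive substitution rule. -/
def IsPrimitive [Fintype ι] [DecidableEq ι] : Prop := σ.substMatrix.IsPrimitive

/-- `p ∈ ω(p)` for every prototile `p`. -/
def FixesPrototiles : Prop := ∀ p, Tile.ofProto p ∈ σ.rule p

/-- `ω` is a nonperiodic substitution rule: the tilings it generates are nonperiodic. -/
def IsNonperiodic : Prop := ∀ p, Nonperiodic (σ.tiling p)

/-- The discrete hull `Ω_punc` of `ω`: the discrete hull of the tilings generated by `ω` (for a
primitive `ω` it is the discrete hull of any one of them). -/
def discreteHull : Set (Set (Tile ι)) := ⋃ q, Pr.discreteHull (σ.tiling q)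

/-- The contraction map of `ωⁿ`:
`Rⁿ(B)_p = ⋃ q, lam⁻ⁿ (B_q + D_pq)`, where `D` is the digit matrix of `ωⁿ`. -/
def contract (n : ℕ) (B : ι → Set Plane) (p : ι) : Set Plane :=
  ⋃ q, ⋃ x ∈ σ.digits n p q, (σ.lam ^ n)⁻¹ • (x +ᵥ B q)

end Substitution

/-! ### Geometric graphs in the prototiles -/

/-- A finite family of parametrised arcs; the edge `e` is drawn in the prototile `host e`.
A pair `a = (e, x)` stands for the translated edge `e + x`, lying in the tile `host e + x`. -/
structure GeomGraph (ι E : Type*) where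
  host : E → ι
  arc : E → C(unitInterval, Plane)

namespace GeomGraph

variable {ι E : Type*} (G : GeomGraph ι E)

/-- The edge `e`, as a subset of the plane. -/
def edge (e : E) : Set Plane := range (G.arc e)

/-- The graph `G_p`, as a subset of the plane. -/
def body (p : ι) : Set Plane := ⋃ e ∈ {e | G.host e = p}, G.edge e

/-- The tile containing a translated edge. -/
def tile (a : E × Plane) : Tile ι := ⟨G.host a.1, a.2⟩

/-- A translated edge, as a subset of the plane. -/
def carrier (a : E × Plane) : Set Plane := a.2 +ᵥ G.edge a.1

/-- The pair of endpoints of a translated edge. -/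
def ends (a : E × Plane) : Sym2 Plane := s(a.2 + G.arc a.1 0, a.2 + G.arc a.1 1)

/-- The vertices of a set of translated edges. -/
def verts (X : Set (E × Plane)) : Set Plane := {u | ∃ a ∈ X, u ∈ G.ends a}

/-- The graph on the points of the plane formed by a set of translated edges. -/
def graph (X : Set (E × Plane)) : SimpleGraph Plane := SimpleGraph.fromEdgeSet (G.ends '' X)

/-- A set of translated edges forms a connected tree (without multiple edges). -/
structure IsTree (X : Set (E × Plane)) : Prop where
  simple : ∀ a ∈ X, ∀ b ∈ X, G.ends a = G.ends b → a = b
  acyclic : (G.graph X).IsAcyclic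
  connected : ∀ u ∈ G.verts X, ∀ w ∈ G.verts X, (G.graph X).Reachable u w

/-- The edges of the copy of `G` in the tile `t`. -/
def edgesOf (t : Tile ι) : Set (E × Plane) := {a | G.tile a = t}

/-- `G` is a consistent family of quasi-dual trees in the prototiles: in each prototile `p` it is
a tree of arcs in `supp p` that meet only in common endpoints; it meets the boundary of `supp p`
only in vertices of degree one; the puncture of `p` is a vertex; and the boundary vertices of
adjacent tiles match in the tilings of `σ`.  (A dual tree is the case of a star: the arcs join the
puncture to boundary vertices, one in the interior of each edge of `p`.) -/
structure IsQuasiDual {Pr : PrototileSet ι} (σ : Substitution Pr) : Prop where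
  arc_injective : ∀ e, Function.Injective (G.arc e)
  arc_mem : ∀ e s, G.arc e s ∈ Pr.supp (G.host e)
  arc_meet : ∀ e e', G.host e = G.host e' → e ≠ e' → ∀ s s', G.arc e s = G.arc e' s' →
    (s = 0 ∨ s = 1) ∧ (s' = 0 ∨ s' = 1)
  isTree : ∀ p, G.IsTree (G.edgesOf (Tile.ofProto p))
  boundary : ∀ e s, G.arc e s ∈ frontier (Pr.supp (G.host e)) → s = 0 ∨ s = 1
  leaf : ∀ e e', G.host e = G.host e' → ∀ s s', G.arc e s = G.arc e' s' →
    G.arc e s ∈ frontier (Pr.supp (G.host e)) → e = e'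
  puncture : ∀ p, (0 : Plane) ∈ G.verts (G.edgesOf (Tile.ofProto p))
  consistent : ∀ q, ∀ t ∈ σ.tiling q, ∀ t' ∈ σ.tiling q, ∀ y ∈ G.verts (G.edgesOf t),
    y ∈ Pr.tileSupp t' → y ∈ G.verts (G.edgesOf t')

end GeomGraph

/-! ### Recurrent pairs and fractal trees -/

/-- The `(e,f)` entry of the edge digit matrix: all `x` such that the tile `host f + x` belongs to
`ωᴺ(host e)` and the scaled edge `lam⁻ᴺ (f + x)` of `G` lies in the edge `e` of `S`. -/
def edgeDigits {ι : Type*} {Pr : PrototileSet ι} {E : Type*} (σ : Substitution Pr)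
    (G S : GeomGraph ι E) (N : ℕ) (e f : E) : Set Plane :=
  {x ∈ σ.digits N (G.host e) (G.host f) | (σ.lam ^ N)⁻¹ • G.carrier (f, x) ⊆ S.edge e}

/-- A recurrent pair `(G, S)`: consistent quasi-dual trees with `S ⊆ Rᴺ(G)`, where `R` is the
contraction map, and a homeomorphism `ψ : G → S` mapping edges onto edges.  The edge `ψ(e)` is
`S.edge e`; it is composed of the edges of `Rᴺ(G)` that it contains. -/
structure RecurrentPair {ι : Type*} {Pr : PrototileSet ι} (σ : Substitution Pr) (E : Type*) where
  G : GeomGraph ι E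
  S : GeomGraph ι E
  isQuasiDual_G : G.IsQuasiDual σ
  isQuasiDual_S : S.IsQuasiDual σ
  host_eq : S.host = G.host
  ψ : ∀ p, G.body p ≃ₜ S.body p
  ψ_edge : ∀ p e, G.host e = p → ∀ y : G.body p, (y : Plane) ∈ G.edge e ↔
    (ψ p y : Plane) ∈ S.edge e
  N : ℕ
  N_pos : 0 < N
  composed : ∀ e, S.edge e = ⋃ f, ⋃ x ∈ edgeDigits σ G S N e f, (σ.lam ^ N)⁻¹ • G.carrier (f, x)

namespace RecurrentPair

variable {ι : Type*} {Pr : PrototileSet ι} {σ : Substitution Pr} {E : Type*}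
  (W : RecurrentPair σ E)

/-- The edge digit matrix `D^E`. -/
def edgeDigit (e f : E) : Set Plane := edgeDigits σ W.G W.S W.N e f

/-- The edge substitution matrix `M^E`. -/
def edgeMatrix : Matrix E E ℝ := Matrix.of fun e f => ((W.edgeDigit e f).ncard : ℝ)

/-- `M^E` is primitive, `κ > 1` is its Perron-Frobenius eigenvalue, and `v` is a corresponding
Perron-Frobenius eigenvector. -/
structure IsPerronFrobenius [Fintype E] [DecidableEq E] (κ : ℝ) (v : E → ℝ) : Prop where
  isPrimitive : W.edgeMatrix.IsPrimitive
  one_lt : 1 < κ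
  pos : ∀ e, 0 < v e
  eigen : W.edgeMatrix.mulVec v = κ • v

/-- `A` is the fractal graph of the recurrent pair: its edges form the attractor of the graph
iterated function system `A_e = ⋃ f, lam⁻ᴺ (A_f + D^E_ef)`, and they are the edges of a consistent
family of quasi-dual trees. -/
structure IsFractalGraph (A : GeomGraph ι E) : Prop where
  host_eq : A.host = W.G.host
  isQuasiDual : A.IsQuasiDual σ
  attractor : ∀ e, A.edge e = ⋃ f, ⋃ x ∈ W.edgeDigit e f, (σ.lam ^ W.N)⁻¹ • A.carrier (f, x)

variable (A : GeomGraph ι E)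

/-- The edges of `Rᴺ(A)_p`.  The pair `a = (f, x)` stands for the scaled edge
`lam⁻ᴺ (A_f + x)`; its tile `host f + x` belongs to `ωᴺ(p)`. -/
def subEdges (p : ι) : Set (E × Plane) := {a | A.tile a ∈ σ.iter W.N p}

/-- The edge of `Rᴺ(A)_p` given by `a`, as a subset of the plane. -/
def subCarrier (a : E × Plane) : Set Plane := (σ.lam ^ W.N)⁻¹ • A.carrier a

/-- The edges of `A°_p`: those edges of `Rᴺ(A)_p` contained in `A_p` that have no endpoint on the
boundary of `p`. -/
def interiorEdges (p : ι) : Set (E × Plane) :=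
  {a ∈ W.subEdges A p | W.subCarrier A a ⊆ A.body p ∧
    ∀ u ∈ A.ends a, (σ.lam ^ W.N)⁻¹ • u ∉ frontier (Pr.supp p)}

/-- The requirements on the first graph `F₁ ⊆ Rᴺ(A)` (given by its edges) of a fractal tree. -/
structure IsFirstTree (F₁ : ι → Set (E × Plane)) : Prop where
  subset : ∀ p, F₁ p ⊆ W.subEdges A p
  isTree : ∀ p, A.IsTree (F₁ p)
  puncture : ∀ p, ∀ t ∈ σ.iter W.N p, t.pos ∈ A.verts (F₁ p)
  interior : ∀ p, ∀ a ∈ F₁ p, W.subCarrier A a ⊆ interior (Pr.supp p)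
  contains : ∀ p, W.interiorEdges A p ⊆ F₁ p

/-- The graphs `F_{k+1}` as subsets of the plane: `F₁` is given by its edges, and
`F_{k+1} = Rᴺ(F_k) ∪ F_k`. -/
def stage (F₁ : ι → Set (E × Plane)) : ℕ → ι → Set Plane
  | 0 => fun p => ⋃ a ∈ F₁ p, W.subCarrier A a
  | k + 1 => fun p => σ.contract W.N (stage F₁ k) p ∪ stage F₁ k p

/-- The union `𝔉_p = ⋃ n ≥ 1, lamᴺⁿ (F_n)_p`, a subset of the plane. -/
def treeBody (F₁ : ι → Set (E × Plane)) (p : ι) : Set Plane :=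
  ⋃ k : ℕ, σ.lam ^ (W.N * (k + 1)) • W.stage A F₁ k p

/-- The edges of the graph `𝔉_p`: the edges of the copies of `A` in the tiles of `T_p` that are
contained in `𝔉_p`. -/
def treeEdges (F₁ : ι → Set (E × Plane)) (p : ι) : Set (E × Plane) :=
  {a | A.tile a ∈ σ.tiling p ∧ A.carrier a ⊆ W.treeBody A F₁ p}

/-- `F₁` generates a fractal tree `𝔉_p` on `T_p`: a connected tree passing through the punctures
of all tiles of `T_p`. -/
structure IsFractalTree (F₁ : ι → Set (E × Plane)) (p : ι) : Prop where
  isFirstTree : W.IsFirstTree A F₁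
  isTree : A.IsTree (W.treeEdges A F₁ p)
  puncture : ∀ t ∈ σ.tiling p, t.pos ∈ A.verts (W.treeEdges A F₁ p)

/-- The length `v e` of the edge of `𝔉_p` with the given pair of endpoints (in a tree there is at
most one such edge). -/
def edgeLength (F₁ : ι → Set (E × Plane)) (v : E → ℝ) (p : ι) (z : Sym2 Plane) : ℝ :=
  ∑ᶠ a ∈ {a ∈ W.treeEdges A F₁ p | A.ends a = z}, v a.1

/-- The fractal distance between two tiles of `T_p`: the sum of the lengths of the edges of the
path in `𝔉_p` between their punctures.  (In a tree there is exactly one path.) -/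
def fractalDist (F₁ : ι → Set (E × Plane)) (v : E → ℝ) (p : ι) (t t' : Tile ι) : ℝ :=
  ⨅ w : (A.graph (W.treeEdges A F₁ p)).Path t.pos t'.pos,
    (w.1.edges.map (W.edgeLength A F₁ v p)).sum

end RecurrentPair

/-! ### The groupoid and its representation -/

namespace Substitution

variable {ι : Type*} {Pr : PrototileSet ι} (σ : Substitution Pr)

/-- The translational equivalence relation `R_punc` on the discrete hull. -/
def Rpunc : Set (Set (Tile ι) × Set (Tile ι)) :=
  {z | z.1 ∈ σ.discreteHull ∧ z.2 ∈ σ.discreteHull ∧ ∃ t ∈ z.1, z.2 = shiftSet z.1 (-t.pos)}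

/-- `U(P,t) = {T ∈ Ω_punc | P - x(t) ⊆ T}`. -/
def U (P : Set (Tile ι)) (t : Tile ι) : Set (Set (Tile ι)) :=
  {T ∈ σ.discreteHull | shiftSet P (-t.pos) ⊆ T}

open Classical in
/-- The function `e(P,t,t')` on `R_punc` (extended by zero): it is `1` at `(T,T')` if
`T ∈ U(P,t)` and `T'` is the translate of `T` that moves to the origin the puncture of the copy of
`t'` in `P - x(t) ⊆ T`. -/
def e (P : Set (Tile ι)) (t t' : Tile ι) (T T' : Set (Tile ι)) : ℂ :=
  if (T, T') ∈ σ.Rpunc ∧ T ∈ σ.U P t ∧ T' = shiftSet T (-(t'.pos - t.pos)) then 1 else 0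

/-- The tiles of `T_p` other than `p`. -/
abbrev OtherTiles (p : ι) : Type _ := {t : Tile ι // t ∈ σ.tiling p ∧ t ≠ Tile.ofProto p}

/-- The Hilbert space `H_p = ℓ²(T_p \ {p})`. -/
abbrev H (p : ι) : Type _ := lp (fun _ : σ.OtherTiles p => ℂ) 2

/-- `B = π_p(f)`, that is, `B` is the bounded operator on `H_p` with
`(B ξ)(s) = ∑_{s'} f(T_p - x(s), T_p - x(s')) ξ(s')`. -/
def IsRepr (p : ι) (f : Set (Tile ι) → Set (Tile ι) → ℂ) (B : σ.H p →L[ℂ] σ.H p) : Prop :=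
  ∀ (ξ : σ.H p) (s : σ.OtherTiles p),
    HasSum (fun s' : σ.OtherTiles p =>
      f (shiftSet (σ.tiling p) (-s.1.pos)) (shiftSet (σ.tiling p) (-s'.1.pos)) * ξ s') (B ξ s)

/-- The self-adjoint operator on `H_p` of multiplication by a real function `g`, with domain
`{ξ | ∑ |g(s) ξ(s)|² < ∞}`. -/
def mulOp (p : ι) (g : σ.OtherTiles p → ℝ) : σ.H p →ₗ.[ℂ] σ.H p where
  domain :=
    { carrier := {ξ | Memℓp (fun s => (g s : ℂ) * ξ s) 2}
      add_mem' := by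
        intro ξ η hξ hη
        have h := Memℓp.add (p := 2) hξ hη
        refine (congrArg (fun F => Memℓp F 2) (funext fun s => ?_)).mp h
        simp [mul_add]
      zero_mem' := by
        have h := zero_memℓp (E := fun _ : σ.OtherTiles p => ℂ) (p := 2)
        refine (congrArg (fun F => Memℓp F 2) (funext fun s => ?_)).mp h
        simp
      smul_mem' := by
        intro c ξ hξ
        have h := Memℓp.const_smul (p := 2) hξ c
        refine (congrArg (fun F => Memℓp F 2) (funext fun s => ?_)).mp h
        simp [mul_left_comm] }
  toFun :=
    { toFun := fun ξ => ⟨fun s => (g s : ℂ) * (ξ : σ.H p) s, ξ.2⟩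
      map_add' := by
        intro ξ η
        ext s
        exact mul_add _ _ _
      map_smul' := by
        intro c ξ
        ext s
        simp [mul_left_comm] }

end Substitution

/-- The operator `D_p δ_s = ln (d(s,p)) δ_s` on `H_p`, where `d` is the fractal distance. -/
def RecurrentPair.D {ι : Type*} {Pr : PrototileSet ι} {σ : Substitution Pr} {E : Type*}
    (W : RecurrentPair σ E) (A : GeomGraph ι E) (F₁ : ι → Set (E × Plane)) (v : E → ℝ) (p : ι) :
    σ.H p →ₗ.[ℂ] σ.H p :=
  σ.mulOp p fun s => Real.log (W.fractalDist A F₁ v p s.1 (Tile.ofProto p))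

end FractalTiling

end

open FractalTiling

/-! Write $\mu=\lambda^N$. The fractal distance from $p$ grows geometrically with the level of
supertiles: a tile in $\omega^{Nn}(p)$ is at distance at most $C\kappa^n$, a tile of $T_p$ outside
it at distance at least $c\kappa^n$. Translating a tile by a bounded vector changes its level by a
bounded amount, so it changes $\ln d_{\mathfrak F_p}(\cdot,p)$ by a bounded amount. By
nonperiodicity $\pi_p(e(P,t,t'))$ moves every tile by the fixed vector between $x(t)$ and $x(t')$.
Its matrix therefore has at most one nonzero entry in each row and column, and the commutator
multiplies these entries by bounded differences of logarithms.

Both estimates (`exists_fractalDist_le`, `exists_le_fractalDist`) rest on one operation, `subdiv`: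
inflate an edge of $A$ by $\mu$ and cut it into edges of $A$. The attractor equation makes this
possible, and $M^Ev=\kappa v$ makes it multiply lengths by $\kappa$. The edges of $\mathfrak F_p$
are exactly the $j$-fold subdivisions, $j\ge 0$, of copies of $F_1$ placed in the supertiles
$\omega^N(t)$, $t\in T_p$.

Upper bound: go from a tile to the centre of its supertile inside a copy of $F_1$, then follow an
inflated route of the previous level; the lengths add up to a geometric series.

Lower bound: copies of $F_1$ lie in the interior of their supertiles, so $\mathfrak F_p$ can leave
$\omega^{N(n+1)}(p)$ only through the inflate of a boundary edge of $A_p$. As $\mathfrak F_p$ is a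
tree containing the inflated inner part of $A_p$, a path from $p$ to the exit must run along that
whole inflated edge, of length $\kappa^{n+1}v_g$. -/

namespace FractalTiling

/-! ### Translates and supports -/

section Tilings

variable {ι : Type*} {Pr : PrototileSet ι} {σ : Substitution Pr}

theorem mem_shiftSet {T : Set (Tile ι)} {x : Plane} {t : Tile ι} :
    t ∈ shiftSet T x ↔ (⟨t.label, t.pos - x⟩ : Tile ι) ∈ T := by
  constructor
  · rintro ⟨s, hs, rfl⟩
    simpa [Tile.shift] using hs
  · intro h
    exact ⟨_, h, by simp [Tile.shift]⟩

theorem shiftSet_shiftSet (T : Set (Tile ι)) (x y : Plane) :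
    shiftSet (shiftSet T x) y = shiftSet T (x + y) := by
  ext t
  simp only [mem_shiftSet]
  rw [show t.pos - y - x = t.pos - (x + y) by abel]

theorem shiftSet_zero (T : Set (Tile ι)) : shiftSet T 0 = T := by
  ext t
  simp [mem_shiftSet]

theorem PrototileSet.mem_tileSupp {t : Tile ι} {y : Plane} :
    y ∈ Pr.tileSupp t ↔ y - t.pos ∈ Pr.supp t.label := by
  rw [PrototileSet.tileSupp, mem_vadd_set_iff_neg_vadd_mem, vadd_eq_add, neg_add_eq_sub]

theorem PrototileSet.mem_interior_tileSupp {t : Tile ι} {y : Plane} :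
    y ∈ interior (Pr.tileSupp t) ↔ y - t.pos ∈ interior (Pr.supp t.label) := by
  rw [PrototileSet.tileSupp, interior_vadd, mem_vadd_set_iff_neg_vadd_mem, vadd_eq_add,
    neg_add_eq_sub]

theorem PrototileSet.closure_interior_tileSupp (t : Tile ι) :
    closure (interior (Pr.tileSupp t)) = Pr.tileSupp t := by
  rw [PrototileSet.tileSupp, interior_vadd, closure_vadd, Pr.closure_interior_supp]

theorem PrototileSet.pos_mem_interior (t : Tile ι) : t.pos ∈ interior (Pr.tileSupp t) := by
  rw [PrototileSet.mem_interior_tileSupp, sub_self]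
  exact Pr.zero_mem_interior _

theorem PrototileSet.tileSupp_ofProto (p : ι) : Pr.tileSupp (Tile.ofProto p) = Pr.supp p := by
  ext y
  simp [PrototileSet.mem_tileSupp, Tile.ofProto]

/-- An open set that misses a set misses its closure, and a tile is the closure of its interior. -/
theorem PrototileSet.disjoint_interior_of_disjoint_interiors {t t' : Tile ι}
    (h : interior (Pr.tileSupp t) ∩ interior (Pr.tileSupp t') = ∅) :
    Disjoint (interior (Pr.tileSupp t)) (Pr.tileSupp t') := by
  rw [← PrototileSet.closure_interior_tileSupp t']
  exact (disjoint_iff_inter_eq_empty.2 h).closure_right isOpen_interior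

theorem PrototileSet.NonOverlapping.disjoint {T : Set (Tile ι)} (hT : Pr.NonOverlapping T)
    {t t' : Tile ι} (ht : t ∈ T) (ht' : t' ∈ T) (hne : t ≠ t') :
    Disjoint (interior (Pr.tileSupp t)) (Pr.tileSupp t') :=
  PrototileSet.disjoint_interior_of_disjoint_interiors (hT t ht t' ht' hne)

theorem PrototileSet.NonOverlapping.eq_of_pos_eq {T : Set (Tile ι)} (hT : Pr.NonOverlapping T)
    {t t' : Tile ι} (ht : t ∈ T) (ht' : t' ∈ T) (h : t.pos = t'.pos) : t = t' := by
  by_contra hne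
  refine (hT.disjoint ht ht' hne).le_bot ⟨Pr.pos_mem_interior t, ?_⟩
  rw [h]
  exact interior_subset (Pr.pos_mem_interior t')

/-- A point of two tiles of a non-overlapping family is a boundary point of the first of them. -/
theorem PrototileSet.NonOverlapping.mem_frontier {T : Set (Tile ι)} (hT : Pr.NonOverlapping T)
    {t t' : Tile ι} (ht : t ∈ T) (ht' : t' ∈ T) (hne : t ≠ t') {y : Plane}
    (hy : y ∈ Pr.tileSupp t) (hy' : y ∈ Pr.tileSupp t') :
    y - t.pos ∈ frontier (Pr.supp t.label) := by
  rw [(Pr.isCompact_supp t.label).isClosed.frontier_eq]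
  refine ⟨PrototileSet.mem_tileSupp.1 hy, fun h => ?_⟩
  exact (hT.disjoint ht ht' hne).le_bot ⟨PrototileSet.mem_interior_tileSupp.2 h, hy'⟩

/-! ### Supertiles and the tilings $T_p$ -/

namespace Substitution

theorem lam_pos : 0 < σ.lam := zero_lt_one.trans σ.one_lt_lam

theorem lam_pow_pos (n : ℕ) : 0 < σ.lam ^ n := pow_pos σ.lam_pos n

theorem mem_onTile {s t : Tile ι} :
    s ∈ σ.onTile t ↔ (⟨s.label, s.pos - σ.lam • t.pos⟩ : Tile ι) ∈ σ.rule t.label := mem_shiftSet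

theorem mem_onSet {X : Set (Tile ι)} {s : Tile ι} :
    s ∈ σ.onSet X ↔ ∃ t ∈ X, s ∈ σ.onTile t := by
  simp [onSet]

theorem onSet_mono {X X' : Set (Tile ι)} (h : X ⊆ X') : σ.onSet X ⊆ σ.onSet X' :=
  biUnion_subset_biUnion_left h

theorem onSet_iterate_mono {X X' : Set (Tile ι)} (h : X ⊆ X') (n : ℕ) :
    σ.onSet^[n] X ⊆ σ.onSet^[n] X' := by
  induction n with
  | zero => exact h
  | succ n ih =>
    rw [Function.iterate_succ_apply', Function.iterate_succ_apply']
    exact onSet_mono ih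

theorem onSet_shiftSet (X : Set (Tile ι)) (x : Plane) :
    σ.onSet (shiftSet X x) = shiftSet (σ.onSet X) (σ.lam • x) := by
  ext s
  simp only [mem_onSet, mem_shiftSet, mem_onTile]
  constructor
  · rintro ⟨t, ht, hs⟩
    refine ⟨_, ht, ?_⟩
    simpa [smul_sub, sub_sub_sub_cancel_right] using hs
  · rintro ⟨t, ht, hs⟩
    refine ⟨t.shift x, by simpa [Tile.shift] using ht, ?_⟩
    simpa [Tile.shift, smul_add, sub_sub, add_comm] using hs

theorem onSet_iterate_shiftSet (n : ℕ) (X : Set (Tile ι)) (x : Plane) :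
    σ.onSet^[n] (shiftSet X x) = shiftSet (σ.onSet^[n] X) (σ.lam ^ n • x) := by
  induction n with
  | zero => simp
  | succ n ih =>
    rw [Function.iterate_succ_apply', Function.iterate_succ_apply', ih, onSet_shiftSet, smul_smul,
      pow_succ']

theorem mem_onSet_iterate_singletons {n : ℕ} {X : Set (Tile ι)} {s : Tile ι} :
    s ∈ σ.onSet^[n] X ↔ ∃ t ∈ X, s ∈ σ.onSet^[n] {t} := by
  induction n generalizing s with
  | zero => simp
  | succ n ih =>
    simp only [Function.iterate_succ_apply', mem_onSet]
    constructor
    · rintro ⟨u, hu, hs⟩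
      obtain ⟨t, ht, hut⟩ := ih.1 hu
      exact ⟨t, ht, u, hut, hs⟩
    · rintro ⟨t, ht, u, hut, hs⟩
      exact ⟨u, ih.2 ⟨t, ht, hut⟩, hs⟩

theorem onSet_iterate_singleton (n : ℕ) (t : Tile ι) :
    σ.onSet^[n] {t} = shiftSet (σ.iter n t.label) (σ.lam ^ n • t.pos) := by
  rw [iter, ← onSet_iterate_shiftSet]
  simp [shiftSet, Tile.shift, Tile.ofProto]

theorem mem_onSet_iterate {n : ℕ} {X : Set (Tile ι)} {s : Tile ι} :
    s ∈ σ.onSet^[n] X ↔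
      ∃ t ∈ X, (⟨s.label, s.pos - σ.lam ^ n • t.pos⟩ : Tile ι) ∈ σ.iter n t.label := by
  rw [mem_onSet_iterate_singletons]
  simp only [onSet_iterate_singleton, mem_shiftSet]

theorem iter_add (m n : ℕ) (p : ι) : σ.iter (m + n) p = σ.onSet^[n] (σ.iter m p) := by
  rw [iter, iter, add_comm, Function.iterate_add_apply]

theorem suppOf_onTile (t : Tile ι) : Pr.suppOf (σ.onTile t) = σ.lam • Pr.tileSupp t := by
  ext y
  have h := σ.suppOf_rule t.label
  rw [PrototileSet.suppOf] at h
  rw [PrototileSet.suppOf, mem_smul_set_iff_inv_smul_mem₀ σ.lam_pos.ne', PrototileSet.mem_tileSupp,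
    show σ.lam⁻¹ • y - t.pos = σ.lam⁻¹ • (y - σ.lam • t.pos) by
      rw [smul_sub, inv_smul_smul₀ σ.lam_pos.ne'],
    ← mem_smul_set_iff_inv_smul_mem₀ σ.lam_pos.ne', ← h]
  simp only [mem_iUnion, exists_prop, mem_onTile]
  constructor
  · rintro ⟨s, hs, hy⟩
    refine ⟨_, hs, ?_⟩
    rw [PrototileSet.mem_tileSupp] at hy ⊢
    simpa using hy
  · rintro ⟨s, hs, hy⟩
    refine ⟨s.shift (σ.lam • t.pos), by simpa [Tile.shift] using hs, ?_⟩
    rw [PrototileSet.mem_tileSupp] at hy ⊢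
    simpa [Tile.shift, sub_sub, add_comm] using hy

theorem tileSupp_subset_of_mem_onTile {s t : Tile ι} (h : s ∈ σ.onTile t) :
    Pr.tileSupp s ⊆ σ.lam • Pr.tileSupp t := by
  rw [← suppOf_onTile]
  exact subset_biUnion_of_mem (u := fun s => Pr.tileSupp s) h

theorem suppOf_onSet (X : Set (Tile ι)) : Pr.suppOf (σ.onSet X) = σ.lam • Pr.suppOf X := by
  rw [PrototileSet.suppOf, onSet, biUnion_iUnion]
  simp only [PrototileSet.suppOf, smul_set_iUnion]
  refine iUnion_congr fun t => ?_
  rw [biUnion_iUnion]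
  refine iUnion_congr fun _ => ?_
  exact suppOf_onTile t

theorem suppOf_onSet_iterate (n : ℕ) (X : Set (Tile ι)) :
    Pr.suppOf (σ.onSet^[n] X) = σ.lam ^ n • Pr.suppOf X := by
  induction n with
  | zero => simp
  | succ n ih =>
    rw [Function.iterate_succ_apply', suppOf_onSet, ih, smul_smul, pow_succ']

theorem suppOf_iter (n : ℕ) (p : ι) : Pr.suppOf (σ.iter n p) = σ.lam ^ n • Pr.supp p := by
  rw [iter, suppOf_onSet_iterate, PrototileSet.suppOf, biUnion_singleton,
    PrototileSet.tileSupp_ofProto]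

theorem nonOverlapping_onTile (t : Tile ι) : Pr.NonOverlapping (σ.onTile t) := by
  intro s hs s' hs' hne
  have key := (σ.isPatch_rule t.label).nonOverlapping _ (mem_onTile.1 hs) _ (mem_onTile.1 hs') (by
    intro h
    rw [Tile.mk.injEq, sub_left_inj] at h
    exact hne (Tile.ext h.1 h.2))
  rw [eq_empty_iff_forall_notMem] at key ⊢
  rintro y ⟨h1, h2⟩
  refine key (y - σ.lam • t.pos) ⟨?_, ?_⟩
  · rw [PrototileSet.mem_interior_tileSupp] at h1 ⊢
    simpa using h1
  · rw [PrototileSet.mem_interior_tileSupp] at h2 ⊢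
    simpa using h2

theorem nonOverlapping_onSet {X : Set (Tile ι)} (hX : Pr.NonOverlapping X) :
    Pr.NonOverlapping (σ.onSet X) := by
  intro s hs s' hs' hne
  obtain ⟨t, ht, hst⟩ := mem_onSet.1 hs
  obtain ⟨t', ht', hst'⟩ := mem_onSet.1 hs'
  by_cases htt : t = t'
  · subst htt
    exact nonOverlapping_onTile t s hst s' hst' hne
  · rw [← disjoint_iff_inter_eq_empty]
    have h := disjoint_iff_inter_eq_empty.2 (hX t ht t' ht' htt)
    refine Disjoint.mono (interior_mono (tileSupp_subset_of_mem_onTile hst))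
      (interior_mono (tileSupp_subset_of_mem_onTile hst')) ?_
    rw [interior_smul₀ σ.lam_pos.ne', interior_smul₀ σ.lam_pos.ne']
    exact (disjoint_image_iff (smul_right_injective _ σ.lam_pos.ne')).2 h

theorem nonOverlapping_iter (n : ℕ) (p : ι) : Pr.NonOverlapping (σ.iter n p) := by
  induction n with
  | zero =>
    intro t ht t' ht' hne
    exact absurd ((mem_singleton_iff.1 ht).trans (mem_singleton_iff.1 ht').symm) hne
  | succ n ih =>
    rw [iter, Function.iterate_succ_apply']
    exact nonOverlapping_onSet ih

theorem finite_onSet {X : Set (Tile ι)} (hX : X.Finite) : (σ.onSet X).Finite :=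
  hX.biUnion fun t _ => (σ.isPatch_rule t.label).finite.image _

theorem finite_iter (n : ℕ) (p : ι) : (σ.iter n p).Finite := by
  induction n with
  | zero => exact finite_singleton _
  | succ n ih =>
    rw [iter, Function.iterate_succ_apply']
    exact finite_onSet ih

theorem iter_subset_succ (hfix : σ.FixesPrototiles) (n : ℕ) (p : ι) : σ.iter n p ⊆ σ.iter (n + 1) p := by
  rw [iter, iter, Function.iterate_succ_apply]
  refine onSet_iterate_mono ?_ n
  rw [singleton_subset_iff, mem_onSet]
  exact ⟨_, mem_singleton _, by simpa [mem_onTile, Tile.ofProto] using hfix p⟩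

theorem iter_mono (hfix : σ.FixesPrototiles) {m n : ℕ} (h : m ≤ n) (p : ι) : σ.iter m p ⊆ σ.iter n p :=
  monotone_nat_of_le_succ (f := fun n => σ.iter n p) (fun n => iter_subset_succ hfix n p) h

theorem ofProto_mem_iter (hfix : σ.FixesPrototiles) (n : ℕ) (p : ι) : Tile.ofProto p ∈ σ.iter n p :=
  iter_mono hfix (Nat.zero_le n) p (mem_singleton _)

theorem ofProto_mem_tiling (p : ι) : Tile.ofProto p ∈ σ.tiling p :=
  mem_iUnion.2 ⟨0, mem_singleton _⟩

theorem nonOverlapping_tiling (hfix : σ.FixesPrototiles) (p : ι) : Pr.NonOverlapping (σ.tiling p) := by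
  intro t ht t' ht' hne
  obtain ⟨m, hm⟩ := mem_iUnion.1 ht
  obtain ⟨n, hn⟩ := mem_iUnion.1 ht'
  exact nonOverlapping_iter (max m n) p t (iter_mono hfix (le_max_left _ _) p hm) t'
    (iter_mono hfix (le_max_right _ _) p hn) hne

theorem mem_tiling_iff (hfix : σ.FixesPrototiles) {p : ι} {k : ℕ} (hk : 0 < k) {t : Tile ι} :
    t ∈ σ.tiling p ↔ ∃ n, t ∈ σ.iter (k * n) p := by
  constructor
  · intro h
    obtain ⟨n, hn⟩ := mem_iUnion.1 h
    exact ⟨n, iter_mono hfix (Nat.le_mul_of_pos_left n hk) p hn⟩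
  · rintro ⟨n, hn⟩
    exact mem_iUnion.2 ⟨_, hn⟩

theorem onSet_iterate_tiling_subset (n : ℕ) (p : ι) : σ.onSet^[n] (σ.tiling p) ⊆ σ.tiling p := by
  intro s hs
  obtain ⟨t, ht, hst⟩ := mem_onSet_iterate_singletons.1 hs
  obtain ⟨m, hm⟩ := mem_iUnion.1 ht
  refine mem_iUnion.2 ⟨m + n, ?_⟩
  rw [iter_add]
  exact mem_onSet_iterate_singletons.2 ⟨t, hm, hst⟩

theorem mem_tiling_of_mem_iter {p : ι} {n : ℕ} {t : Tile ι} (ht : t ∈ σ.tiling p) {q : ι}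
    {x : Plane} (h : (⟨q, x⟩ : Tile ι) ∈ σ.iter n t.label) :
    (⟨q, x + σ.lam ^ n • t.pos⟩ : Tile ι) ∈ σ.tiling p :=
  onSet_iterate_tiling_subset n p (mem_onSet_iterate.2 ⟨t, ht, by simpa using h⟩)

/-- A tile of `T_p` outside of the supertile `ωⁿ(p)` does not meet the interior of its support. -/
theorem disjoint_interior_of_notMem_iter (hfix : σ.FixesPrototiles) {p : ι} {n : ℕ} {t : Tile ι} (ht : t ∈ σ.tiling p)
    (hn : t ∉ σ.iter n p) :
    Disjoint (interior (Pr.tileSupp t)) (σ.lam ^ n • Pr.supp p) := by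
  rw [← suppOf_iter, PrototileSet.suppOf, disjoint_iUnion₂_right]
  intro u hu
  refine (nonOverlapping_tiling hfix p).disjoint ht (mem_iUnion.2 ⟨n, hu⟩) ?_
  rintro rfl
  exact hn hu

theorem tileSupp_subset_of_mem_iter {p : ι} {n : ℕ} {t : Tile ι} (ht : t ∈ σ.iter n p) :
    Pr.tileSupp t ⊆ σ.lam ^ n • Pr.supp p := by
  rw [← suppOf_iter, PrototileSet.suppOf]
  exact subset_biUnion_of_mem (u := fun s => Pr.tileSupp s) ht

end Substitution

end Tilings

end FractalTiling

namespace FractalTiling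

/-! ### Graphs whose edges are arcs meeting only in common endpoints -/

namespace GeomGraph

variable {ι E : Type*} {A : GeomGraph ι E}

/-- The parametrisation of a translated edge. -/
def pt (A : GeomGraph ι E) (a : E × Plane) (s : unitInterval) : Plane := a.2 + A.arc a.1 s

theorem continuous_pt (a : E × Plane) : Continuous (A.pt a) :=
  continuous_const.add (A.arc a.1).continuous

theorem carrier_eq_range (a : E × Plane) : A.carrier a = range (A.pt a) := by
  rw [carrier, edge, ← image_vadd, ← range_comp]
  rfl

theorem pt_mem_carrier (a : E × Plane) (s : unitInterval) : A.pt a s ∈ A.carrier a := by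
  rw [carrier_eq_range]
  exact mem_range_self s

theorem ends_eq (a : E × Plane) : A.ends a = s(A.pt a 0, A.pt a 1) := rfl

theorem mem_ends {a : E × Plane} {u : Plane} : u ∈ A.ends a ↔ u = A.pt a 0 ∨ u = A.pt a 1 := by
  rw [ends_eq, Sym2.mem_iff]

theorem pt_mem_ends {a : E × Plane} {s : unitInterval} (h : s = 0 ∨ s = 1) :
    A.pt a s ∈ A.ends a := by
  rw [mem_ends]
  rcases h with rfl | rfl
  · exact Or.inl rfl
  · exact Or.inr rfl

theorem mem_carrier_of_mem_ends {a : E × Plane} {u : Plane} (h : u ∈ A.ends a) :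
    u ∈ A.carrier a := by
  rcases mem_ends.1 h with rfl | rfl <;> exact pt_mem_carrier _ _

theorem isPreconnected_carrier (a : E × Plane) : IsPreconnected (A.carrier a) := by
  rw [carrier_eq_range]
  exact isPreconnected_range (continuous_pt a)

theorem isCompact_carrier (a : E × Plane) : IsCompact (A.carrier a) := by
  rw [carrier_eq_range]
  exact isCompact_range (continuous_pt a)

/-- The midpoint of the parameter interval. -/
noncomputable def mid : unitInterval := ⟨1 / 2, by norm_num, by norm_num⟩

theorem mid_ne : ¬(mid = 0 ∨ mid = 1) := by
  rintro (h | h) <;> · have := congrArg Subtype.val h; norm_num [mid] at this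

/-- The union of a set of translated edges. -/
def union (A : GeomGraph ι E) (X : Set (E × Plane)) : Set Plane := ⋃ a ∈ X, A.carrier a

theorem mem_union {X : Set (E × Plane)} {y : Plane} :
    y ∈ A.union X ↔ ∃ a ∈ X, y ∈ A.carrier a := by
  simp [union]

theorem carrier_subset_union {X : Set (E × Plane)} {a : E × Plane} (ha : a ∈ X) :
    A.carrier a ⊆ A.union X := subset_biUnion_of_mem (u := fun a => A.carrier a) ha

theorem union_singleton (a : E × Plane) : A.union {a} = A.carrier a := by
  simp [union]

/-- Different edges in `X` meet only in common endpoints. -/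
def Noncrossing (A : GeomGraph ι E) (X : Set (E × Plane)) : Prop :=
  ∀ a ∈ X, ∀ b ∈ X, a ≠ b → ∀ s s', A.pt a s = A.pt b s' → (s = 0 ∨ s = 1) ∧ (s' = 0 ∨ s' = 1)

theorem Noncrossing.mono {X X' : Set (E × Plane)} (h : A.Noncrossing X) (hX : X' ⊆ X) :
    A.Noncrossing X' := fun a ha b hb => h a (hX ha) b (hX hb)

/-- The midpoint serves as a point that identifies its edge: inclusions between point sets become
equalities of edges by testing them there. -/
theorem Noncrossing.eq_of_mid_mem {X : Set (E × Plane)} (h : A.Noncrossing X) {a b : E × Plane}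
    (ha : a ∈ X) (hb : b ∈ X) (hab : A.pt a mid ∈ A.carrier b) : a = b := by
  by_contra hne
  rw [carrier_eq_range] at hab
  obtain ⟨s, hs⟩ := hab
  exact mid_ne (h a ha b hb hne mid s hs.symm).1

/-- A common point of two different edges is an endpoint of both. -/
theorem Noncrossing.mem_ends {X : Set (E × Plane)} (h : A.Noncrossing X) {a b : E × Plane}
    (ha : a ∈ X) (hb : b ∈ X) (hab : a ≠ b) {y : Plane} (hya : y ∈ A.carrier a)
    (hyb : y ∈ A.carrier b) : y ∈ A.ends a ∧ y ∈ A.ends b := by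
  rw [carrier_eq_range] at hya hyb
  obtain ⟨s, rfl⟩ := hya
  obtain ⟨s', hs'⟩ := hyb
  obtain ⟨h1, h2⟩ := h a ha b hb hab s s' hs'.symm
  exact ⟨pt_mem_ends h1, hs' ▸ pt_mem_ends h2⟩

theorem graph_mono {X X' : Set (E × Plane)} (h : X ⊆ X') : A.graph X ≤ A.graph X' :=
  SimpleGraph.fromEdgeSet_mono (image_mono h)

theorem exists_ends_of_mem_edgeSet {X : Set (E × Plane)} {z : Sym2 Plane}
    (hz : z ∈ (A.graph X).edgeSet) : ∃ a ∈ X, A.ends a = z := by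
  rw [graph, SimpleGraph.edgeSet_fromEdgeSet] at hz
  exact hz.1

theorem exists_ends_of_adj {X : Set (E × Plane)} {u w : Plane} (h : (A.graph X).Adj u w) :
    ∃ a ∈ X, A.ends a = s(u, w) := exists_ends_of_mem_edgeSet (SimpleGraph.mem_edgeSet _ |>.2 h)

theorem reachable_of_mem_ends {X : Set (E × Plane)} {a : E × Plane} (ha : a ∈ X) {u w : Plane}
    (hu : u ∈ A.ends a) (hw : w ∈ A.ends a) : (A.graph X).Reachable u w := by
  by_cases huw : u = w
  · rw [huw]
  · refine SimpleGraph.Adj.reachable ?_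
    rw [graph, SimpleGraph.fromEdgeSet_adj]
    exact ⟨⟨a, ha, ((Sym2.mem_and_mem_iff huw).1 ⟨hu, hw⟩)⟩, huw⟩

/-- If finitely many edges have a connected union, then they form a connected graph. -/
theorem Noncrossing.reachable {X : Set (E × Plane)} (h : A.Noncrossing X) (hfin : X.Finite)
    (hconn : IsPreconnected (A.union X)) {u w : Plane} (hu : u ∈ A.verts X) (hw : w ∈ A.verts X) :
    (A.graph X).Reachable u w := by
  -- The edges in the component of `u`. If `X₁` were not all of `X`, the closed unions of `X₁` and
  -- of its complement would share a point by connectedness; this is a common endpoint, which puts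
  -- an edge of the complement into the component.
  set X₁ := {a ∈ X | ∃ y ∈ A.ends a, (A.graph X).Reachable u y} with hX₁
  obtain ⟨a, ha, hua⟩ := hu
  obtain ⟨b, hb, hwb⟩ := hw
  have ha₁ : a ∈ X₁ := ⟨ha, u, hua, .refl _⟩
  suffices hb₁ : b ∈ X₁ by
    obtain ⟨y, hy, huy⟩ := hb₁.2
    exact huy.trans (reachable_of_mem_ends hb hy hwb)
  by_contra hb₁
  have hclosed : ∀ Z ⊆ X, IsClosed (A.union Z) := fun Z hZ =>
    (hfin.subset hZ).isClosed_biUnion fun c _ => (isCompact_carrier c).isClosed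
  obtain ⟨y, -, hy₁, hy₂⟩ := isPreconnected_closed_iff.1 hconn (A.union X₁) (A.union (X \ X₁))
    (hclosed _ (sep_subset _ _)) (hclosed _ sdiff_subset)
    (fun y hy => by
      obtain ⟨c, hc, hyc⟩ := mem_union.1 hy
      by_cases hc₁ : c ∈ X₁
      · exact Or.inl (mem_union.2 ⟨c, hc₁, hyc⟩)
      · exact Or.inr (mem_union.2 ⟨c, ⟨hc, hc₁⟩, hyc⟩))
    ⟨A.pt a 0, carrier_subset_union ha (pt_mem_carrier a 0),
      carrier_subset_union ha₁ (pt_mem_carrier a 0)⟩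
    ⟨A.pt b 0, carrier_subset_union hb (pt_mem_carrier b 0),
      carrier_subset_union (X := X \ X₁) ⟨hb, hb₁⟩ (pt_mem_carrier b 0)⟩
  obtain ⟨c, hc, hyc⟩ := mem_union.1 hy₁
  obtain ⟨d, hd, hyd⟩ := mem_union.1 hy₂
  obtain ⟨hc', hd'⟩ := h.mem_ends hc.1 hd.1 (fun hcd => hd.2 (hcd ▸ hc)) hyc hyd
  obtain ⟨z, hz, huz⟩ := hc.2
  exact hd.2 ⟨hd.1, y, hd', huz.trans (reachable_of_mem_ends hc.1 hz hc')⟩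

/-- The endpoints of an arc are endpoints of every arc contained in it that passes through
them. -/
theorem eq_zero_or_one_of_range_subset {α γ : unitInterval → Plane} (hα : Continuous α)
    (hα' : Function.Injective α) (hγ : Continuous γ) (hγ' : Function.Injective γ)
    (hsub : range α ⊆ range γ) {s r : unitInterval} (hr : r = 0 ∨ r = 1) (hs : α s = γ r) :
    s = 0 ∨ s = 1 := by
  have hemb : Topology.IsEmbedding γ := (hγ.isClosedEmbedding hγ').isEmbedding
  -- Since `γ` is an embedding, `α` factors as `γ ∘ φ` with `φ` a continuous injection of the
  -- interval into itself. Such a map is strictly monotone, so it cannot take an interior parameter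
  -- to 0 or 1.
  have hex : ∀ x, ∃ y, γ y = α x := fun x => hsub (mem_range_self x)
  choose φ hφ using hex
  have hφc : Continuous φ := by
    rw [hemb.continuous_iff, show γ ∘ φ = α from funext hφ]
    exact hα
  have hφi : Function.Injective φ := fun x y hxy => hα' (by rw [← hφ, ← hφ, hxy])
  have hφs : φ s = r := hγ' (by rw [hφ, hs])
  by_contra! hcon
  have h0 : 0 < s := unitInterval.pos_iff_ne_zero.2 hcon.1
  have h1 : s < 1 := unitInterval.lt_one_iff_ne_one.2 hcon.2
  rcases hφc.strictMono_of_inj hφi with hm | hm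
  · have hl := hm h0
    have hu := hm h1
    rw [hφs] at hl hu
    rcases hr with rfl | rfl
    · exact hl.not_ge unitInterval.nonneg'
    · exact hu.not_ge unitInterval.le_one'
  · have hl := hm h0
    have hu := hm h1
    rw [hφs] at hl hu
    rcases hr with rfl | rfl
    · exact hu.not_ge unitInterval.nonneg'
    · exact hl.not_ge unitInterval.le_one'

theorem pt_injective (hinj : ∀ e, Function.Injective (A.arc e)) (a : E × Plane) :
    Function.Injective (A.pt a) := fun _ _ h => hinj a.1 (add_left_cancel h)

/-- If edges cover an arc and are contained in it, then its endpoints are vertices. -/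
theorem mem_verts_of_union_eq (hinj : ∀ e, Function.Injective (A.arc e)) {X : Set (E × Plane)}
    {γ : unitInterval → Plane} (hγ : Continuous γ) (hγ' : Function.Injective γ)
    (hX : A.union X = range γ) {r : unitInterval} (hr : r = 0 ∨ r = 1) : γ r ∈ A.verts X := by
  obtain ⟨a, ha, hra⟩ := mem_union.1 (hX ▸ mem_range_self r : γ r ∈ A.union X)
  have hsub := carrier_subset_union (A := A) ha
  rw [hX, carrier_eq_range] at hsub
  rw [carrier_eq_range] at hra
  obtain ⟨s, hs⟩ := hra
  refine ⟨a, ha, hs ▸ pt_mem_ends ?_⟩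
  exact eq_zero_or_one_of_range_subset (continuous_pt a) (pt_injective hinj a) hγ hγ' hsub hr hs

/-- The edges of a walk connect its endpoints in the plane. -/
theorem exists_isPreconnected_of_walk {X : Set (E × Plane)} {u w : Plane}
    (p : (A.graph X).Walk u w) :
    ∃ C, IsPreconnected C ∧ u ∈ C ∧ w ∈ C ∧
      C ⊆ {u} ∪ A.union {a ∈ X | A.ends a ∈ p.edges} := by
  induction p with
  | nil => exact ⟨{_}, isPreconnected_singleton, rfl, rfl, subset_union_left⟩
  | @cons u u' w h p ih =>
    obtain ⟨C, hC, hu', hw, hsub⟩ := ih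
    obtain ⟨a, ha, hends⟩ := exists_ends_of_adj h
    have hmem : a ∈ {a ∈ X | A.ends a ∈ (SimpleGraph.Walk.cons h p).edges} :=
      ⟨ha, by simp [hends]⟩
    have hua : u ∈ A.carrier a := mem_carrier_of_mem_ends (by rw [hends]; exact Sym2.mem_mk_left _ _)
    have hua' : u' ∈ A.carrier a :=
      mem_carrier_of_mem_ends (by rw [hends]; exact Sym2.mem_mk_right _ _)
    refine ⟨A.carrier a ∪ C, (isPreconnected_carrier a).union u' hua' hu' hC, Or.inl hua,
      Or.inr hw, union_subset ((carrier_subset_union hmem).trans subset_union_right) ?_⟩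
    refine hsub.trans (union_subset ?_ ?_)
    · rw [singleton_subset_iff]
      exact Or.inr (carrier_subset_union hmem hua')
    · refine Subset.trans ?_ subset_union_right
      refine biUnion_subset_biUnion_left fun b hb => ⟨hb.1, ?_⟩
      rw [SimpleGraph.Walk.edges_cons]
      exact List.mem_cons_of_mem _ hb.2

/-- A walk between the endpoints of an arc along edges that subdivide the arc uses all of the
edges. -/
theorem Noncrossing.ends_mem_edges (hinj : ∀ e, Function.Injective (A.arc e))
    {X : Set (E × Plane)} (h : A.Noncrossing X) {γ : unitInterval → Plane} (hγ : Continuous γ)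
    (hγ' : Function.Injective γ) (hX : A.union X = range γ)
    (p : (A.graph X).Walk (γ 0) (γ 1)) {a : E × Plane} (ha : a ∈ X) : A.ends a ∈ p.edges := by
  obtain ⟨C, hC, h0, h1, hsub⟩ := exists_isPreconnected_of_walk p
  have hcl : Topology.IsClosedEmbedding γ := hγ.isClosedEmbedding hγ'
  have hCγ : C ⊆ range γ := by
    rw [← hX]
    refine hsub.trans (union_subset ?_ (biUnion_subset_biUnion_left (sep_subset _ _)))
    rw [singleton_subset_iff, hX]
    exact mem_range_self 0
  -- Pulled back to the interval, `C` is a connected set containing 0 and 1, hence everything: the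
  -- walk covers the whole arc.
  have hpre : IsPreconnected (γ ⁻¹' C) := by
    rw [← hcl.isInducing.isPreconnected_image, image_preimage_eq_of_subset hCγ]
    exact hC
  have hall : ∀ s, γ s ∈ C := fun s =>
    hpre.Icc_subset (a := 0) (b := 1) h0 h1 ⟨unitInterval.nonneg', unitInterval.le_one'⟩
  have hmid : A.pt a mid ∈ C := by
    have : A.pt a mid ∈ A.union X := carrier_subset_union ha (pt_mem_carrier a mid)
    rw [hX] at this
    obtain ⟨s, hs⟩ := this
    exact hs ▸ hall s
  rcases hsub hmid with hm | hm
  -- The midpoint of `a` cannot be the starting point `γ 0`: that is a vertex of `X`, and a midpoint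
  -- is an endpoint of no edge.
  · exfalso
    rw [mem_singleton_iff] at hm
    obtain ⟨b, hb, hbe⟩ := mem_verts_of_union_eq hinj hγ hγ' hX (r := 0) (Or.inl rfl)
    rw [← hm] at hbe
    have hab := h.eq_of_mid_mem ha hb (mem_carrier_of_mem_ends hbe)
    subst hab
    refine mid_ne ?_
    rcases GeomGraph.mem_ends.1 hbe with h2 | h2
    · exact Or.inl (pt_injective hinj a h2)
    · exact Or.inr (pt_injective hinj a h2)
  · obtain ⟨b, hb, hbm⟩ := mem_union.1 hm
    rw [h.eq_of_mid_mem ha hb.1 hbm]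
    exact hb.2

end GeomGraph

end FractalTiling

namespace FractalTiling

/-! ### Subdivision of the edges of the fractal graph -/

section Subdivision

variable {ι E : Type*} {Pr : PrototileSet ι} {σ : Substitution Pr} {A : GeomGraph ι E}
  {W : RecurrentPair σ E}

/-- The edges of the copies of `A` in the tiles of `T_p`. -/
def GeomGraph.tilingEdges (A : GeomGraph ι E) (σ : Substitution Pr) (p : ι) : Set (E × Plane) :=
  {a | A.tile a ∈ σ.tiling p}

theorem GeomGraph.mem_carrier {a : E × Plane} {y : Plane} :
    y ∈ A.carrier a ↔ y - a.2 ∈ A.edge a.1 := by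
  rw [GeomGraph.carrier, mem_vadd_set_iff_neg_vadd_mem, vadd_eq_add, neg_add_eq_sub]

theorem GeomGraph.pt_sub (a : E × Plane) (s : unitInterval) : A.pt a s - a.2 = A.arc a.1 s :=
  add_sub_cancel_left _ _

theorem GeomGraph.IsQuasiDual.carrier_subset (h : A.IsQuasiDual σ) (a : E × Plane) :
    A.carrier a ⊆ Pr.tileSupp (A.tile a) := by
  intro y hy
  obtain ⟨s, hs⟩ := GeomGraph.mem_carrier.1 hy
  rw [PrototileSet.mem_tileSupp]
  change y - a.2 ∈ Pr.supp (A.host a.1)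
  rw [← hs]
  exact h.arc_mem _ _

/-- Inside one tile this is part of being quasi-dual. A point common to two tiles lies on the
boundary of both, where the trees have only vertices. -/
theorem GeomGraph.IsQuasiDual.noncrossing (h : A.IsQuasiDual σ) (hfix : σ.FixesPrototiles)
    (p : ι) : A.Noncrossing (A.tilingEdges σ p) := by
  intro a ha b hb hab s s' hss
  by_cases ht : A.tile a = A.tile b
  · obtain ⟨hhost, hpos⟩ := Tile.mk.inj ht
    refine h.arc_meet a.1 b.1 hhost (fun he => hab (Prod.ext he hpos)) s s' ?_
    rw [← A.pt_sub, ← A.pt_sub, hss, hpos]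
  · have hsa := h.carrier_subset a (A.pt_mem_carrier a s)
    have hsb := h.carrier_subset b (A.pt_mem_carrier b s')
    have hno := Substitution.nonOverlapping_tiling hfix p
    refine ⟨h.boundary a.1 s ?_, h.boundary b.1 s' ?_⟩
    · rw [← A.pt_sub]
      exact hno.mem_frontier ha hb ht hsa (hss ▸ hsb)
    · rw [← A.pt_sub]
      exact hno.mem_frontier hb ha (Ne.symm ht) hsb (hss ▸ hsa)

namespace RecurrentPair

/-- The edges of `A` subdividing the edges in `X`, scaled by `lamᴺ`. -/
def subdiv (W : RecurrentPair σ E) (X : Set (E × Plane)) : Set (E × Plane) :=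
  {c | ∃ a ∈ X, c.2 - σ.lam ^ W.N • a.2 ∈ W.edgeDigit a.1 c.1}

theorem subdiv_mono {X X' : Set (E × Plane)} (h : X ⊆ X') : W.subdiv X ⊆ W.subdiv X' := by
  rintro c ⟨a, ha, hc⟩
  exact ⟨a, h ha, hc⟩

theorem subdiv_iterate_mono {X X' : Set (E × Plane)} (h : X ⊆ X') (n : ℕ) :
    W.subdiv^[n] X ⊆ W.subdiv^[n] X' := by
  induction n with
  | zero => exact h
  | succ n ih =>
    rw [Function.iterate_succ_apply', Function.iterate_succ_apply']
    exact subdiv_mono ih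

theorem mem_subdiv_singletons {X : Set (E × Plane)} {c : E × Plane} :
    c ∈ W.subdiv X ↔ ∃ a ∈ X, c ∈ W.subdiv {a} := by
  simp [subdiv]

theorem mem_subdiv_iterate_singletons {n : ℕ} {X : Set (E × Plane)} {c : E × Plane} :
    c ∈ W.subdiv^[n] X ↔ ∃ a ∈ X, c ∈ W.subdiv^[n] {a} := by
  induction n generalizing c with
  | zero => simp
  | succ n ih =>
    simp only [Function.iterate_succ_apply']
    rw [mem_subdiv_singletons]
    constructor
    · rintro ⟨b, hb, hc⟩
      obtain ⟨a, ha, hba⟩ := ih.1 hb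
      exact ⟨a, ha, mem_subdiv_singletons.2 ⟨b, hba, hc⟩⟩
    · rintro ⟨a, ha, hc⟩
      obtain ⟨b, hb, hcb⟩ := mem_subdiv_singletons.1 hc
      exact ⟨b, ih.2 ⟨a, ha, hb⟩, hcb⟩

theorem subdiv_eq_biUnion (X : Set (E × Plane)) : W.subdiv X = ⋃ a ∈ X, W.subdiv {a} := by
  ext c
  rw [mem_subdiv_singletons]
  simp

theorem edgeDigit_finite (e f : E) : (W.edgeDigit e f).Finite := by
  refine Finite.subset ?_ (sep_subset _ _)
  exact (Substitution.finite_iter W.N (W.G.host e)).preimage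
    (fun x _ y _ h => (Tile.mk.inj h).2)

theorem finite_subdiv_singleton [Finite E] (a : E × Plane) : (W.subdiv {a}).Finite := by
  refine (finite_iUnion fun f => (W.edgeDigit_finite a.1 f).image
    fun z => (f, z + σ.lam ^ W.N • a.2)).subset ?_
  rintro ⟨f, x⟩ ⟨b, rfl, hc⟩
  exact mem_iUnion.2 ⟨f, _, hc, by simp⟩

theorem finite_subdiv [Finite E] {X : Set (E × Plane)} (hX : X.Finite) : (W.subdiv X).Finite := by
  rw [subdiv_eq_biUnion]
  exact hX.biUnion fun a _ => finite_subdiv_singleton a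

theorem finite_subdiv_iterate [Finite E] {X : Set (E × Plane)} (hX : X.Finite) (n : ℕ) :
    (W.subdiv^[n] X).Finite := by
  induction n with
  | zero => exact hX
  | succ n ih =>
    rw [Function.iterate_succ_apply']
    exact finite_subdiv ih

theorem scale_pos : 0 < σ.lam ^ W.N := σ.lam_pow_pos W.N

theorem one_lt_scale : 1 < σ.lam ^ W.N := one_lt_pow₀ σ.one_lt_lam W.N_pos.ne'

theorem scale_pow_pos (n : ℕ) : 0 < (σ.lam ^ W.N) ^ n := pow_pos W.scale_pos n

namespace IsFractalGraph

theorem subdiv_subset (hA : W.IsFractalGraph A) {p : ι} {X : Set (E × Plane)} (hX : X ⊆ A.tilingEdges σ p) :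
    W.subdiv X ⊆ A.tilingEdges σ p := by
  rintro c ⟨a, ha, hc⟩
  have h1 : (⟨A.host c.1, c.2 - σ.lam ^ W.N • a.2⟩ : Tile ι) ∈ σ.iter W.N (A.tile a).label := by
    rw [GeomGraph.tile, hA.host_eq]
    exact hc.1
  have := Substitution.mem_tiling_of_mem_iter (hX ha) h1
  change A.tile c ∈ σ.tiling p
  simpa [GeomGraph.tile] using this

theorem subdiv_iterate_subset (hA : W.IsFractalGraph A) {p : ι} {X : Set (E × Plane)} (hX : X ⊆ A.tilingEdges σ p) (n : ℕ) :
    W.subdiv^[n] X ⊆ A.tilingEdges σ p := by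
  induction n with
  | zero => exact hX
  | succ n ih =>
    rw [Function.iterate_succ_apply']
    exact hA.subdiv_subset ih

theorem mem_edge (hA : W.IsFractalGraph A) {e : E} {y : Plane} :
    y ∈ A.edge e ↔ ∃ f, ∃ x ∈ W.edgeDigit e f, σ.lam ^ W.N • y - x ∈ A.edge f := by
  conv_lhs => rw [hA.attractor]
  simp only [mem_iUnion, exists_prop, GeomGraph.mem_carrier,
    mem_smul_set_iff_inv_smul_mem₀ (inv_ne_zero W.scale_pos.ne'), inv_inv]

/-- The attractor equation, multiplied by $\lambda^N$. -/
theorem union_subdiv (hA : W.IsFractalGraph A) (X : Set (E × Plane)) :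
    A.union (W.subdiv X) = σ.lam ^ W.N • A.union X := by
  ext y
  rw [mem_smul_set_iff_inv_smul_mem₀ W.scale_pos.ne', GeomGraph.mem_union, GeomGraph.mem_union]
  constructor
  · rintro ⟨c, ⟨a, ha, hc⟩, hy⟩
    refine ⟨a, ha, GeomGraph.mem_carrier.2 (hA.mem_edge.2 ⟨c.1, _, hc, ?_⟩)⟩
    rw [smul_sub, smul_inv_smul₀ W.scale_pos.ne', sub_sub_sub_cancel_right]
    exact GeomGraph.mem_carrier.1 hy
  · rintro ⟨a, ha, hy⟩
    obtain ⟨f, x, hx, hy⟩ := hA.mem_edge.1 (GeomGraph.mem_carrier.1 hy)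
    refine ⟨(f, x + σ.lam ^ W.N • a.2), ⟨a, ha, by simpa using hx⟩, GeomGraph.mem_carrier.2 ?_⟩
    rw [smul_sub, smul_inv_smul₀ W.scale_pos.ne', sub_sub, add_comm] at hy
    exact hy

theorem union_subdiv_iterate (hA : W.IsFractalGraph A) (X : Set (E × Plane)) (n : ℕ) :
    A.union (W.subdiv^[n] X) = (σ.lam ^ W.N) ^ n • A.union X := by
  induction n with
  | zero => simp
  | succ n ih =>
    rw [Function.iterate_succ_apply', hA.union_subdiv, ih, smul_smul, pow_succ']

theorem carrier_subset_of_mem_subdiv (hA : W.IsFractalGraph A) {a c : E × Plane} {n : ℕ} (hc : c ∈ W.subdiv^[n] {a}) :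
    A.carrier c ⊆ (σ.lam ^ W.N) ^ n • A.carrier a := by
  rw [← A.union_singleton a, ← hA.union_subdiv_iterate]
  exact GeomGraph.carrier_subset_union hc

theorem range_smul_pt (hA : W.IsFractalGraph A) (a : E × Plane) (n : ℕ) :
    A.union (W.subdiv^[n] {a}) = range fun s => (σ.lam ^ W.N) ^ n • A.pt a s := by
  rw [hA.union_subdiv_iterate, A.union_singleton, A.carrier_eq_range, ← image_smul, ← range_comp]
  rfl

theorem smul_pt_injective (hinj : ∀ e, Function.Injective (A.arc e)) (a : E × Plane) (n : ℕ) :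
    Function.Injective fun s => (σ.lam ^ W.N) ^ n • A.pt a s :=
  (smul_right_injective _ (W.scale_pow_pos n).ne').comp (A.pt_injective hinj a)

theorem continuous_smul_pt (a : E × Plane) (n : ℕ) :
    Continuous fun s => (σ.lam ^ W.N) ^ n • A.pt a s :=
  (A.continuous_pt a).fun_const_smul _

theorem smul_mem_verts (hA : W.IsFractalGraph A) {a : E × Plane} {u : Plane} (hu : u ∈ A.ends a) (n : ℕ) :
    (σ.lam ^ W.N) ^ n • u ∈ A.verts (W.subdiv^[n] {a}) := by
  have hinj := hA.isQuasiDual.arc_injective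
  have key := fun r hr => GeomGraph.mem_verts_of_union_eq hinj (continuous_smul_pt (W := W) a n)
    (smul_pt_injective hinj a n) (hA.range_smul_pt a n) (r := r) hr
  rcases GeomGraph.mem_ends.1 hu with rfl | rfl
  · exact key 0 (Or.inl rfl)
  · exact key 1 (Or.inr rfl)

/-- Each edge of a walk is replaced by its subdivision, a finite noncrossing family whose union is
an arc, hence a connected graph containing the inflated endpoints as vertices. -/
theorem reachable_subdiv (hA : W.IsFractalGraph A) [Finite E] (hfix : σ.FixesPrototiles) {p : ι} {X : Set (E × Plane)}
    (hX : X ⊆ A.tilingEdges σ p) (n : ℕ) {u w : Plane} (h : (A.graph X).Reachable u w) :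
    (A.graph (W.subdiv^[n] X)).Reachable ((σ.lam ^ W.N) ^ n • u) ((σ.lam ^ W.N) ^ n • w) := by
  obtain ⟨q⟩ := h
  induction q with
  | nil => exact .refl _
  | cons hadj q ih =>
    refine SimpleGraph.Reachable.trans ?_ ih
    obtain ⟨a, ha, hends⟩ := GeomGraph.exists_ends_of_adj hadj
    have haX : ({a} : Set (E × Plane)) ⊆ X := singleton_subset_iff.2 ha
    refine SimpleGraph.Reachable.mono (GeomGraph.graph_mono (subdiv_iterate_mono haX n)) ?_
    refine GeomGraph.Noncrossing.reachable ((hA.isQuasiDual.noncrossing hfix p).mono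
      (hA.subdiv_iterate_subset (haX.trans hX) n))
      (finite_subdiv_iterate (finite_singleton a) n) ?_ ?_ ?_
    · rw [hA.range_smul_pt]
      exact isPreconnected_range (continuous_smul_pt a n)
    · exact hA.smul_mem_verts (hends ▸ Sym2.mem_mk_left _ _) n
    · exact hA.smul_mem_verts (hends ▸ Sym2.mem_mk_right _ _) n

/-- A common piece would lie in the intersection of two inflated edges, which consists of at most
two points, whereas an arc is infinite. -/
theorem disjoint_subdiv (hA : W.IsFractalGraph A) (hfix : σ.FixesPrototiles) {p : ι} {a b : E × Plane}
    (ha : a ∈ A.tilingEdges σ p) (hb : b ∈ A.tilingEdges σ p) (hab : a ≠ b) (n : ℕ) :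
    Disjoint (W.subdiv^[n] {a}) (W.subdiv^[n] {b}) := by
  rw [Set.disjoint_left]
  intro c hca hcb
  have hsub : A.carrier c ⊆ (σ.lam ^ W.N) ^ n • ({A.pt a 0, A.pt a 1} : Set Plane) := by
    intro y hy
    have h1 := hA.carrier_subset_of_mem_subdiv hca hy
    have h2 := hA.carrier_subset_of_mem_subdiv hcb hy
    rw [mem_smul_set_iff_inv_smul_mem₀ (W.scale_pow_pos n).ne'] at h1 h2 ⊢
    exact GeomGraph.mem_ends.1
      ((hA.isQuasiDual.noncrossing hfix p).mem_ends ha hb hab h1 h2).1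
  have hinf : (A.carrier c).Infinite := by
    rw [A.carrier_eq_range]
    have : Infinite unitInterval := (Icc_infinite zero_lt_one).to_subtype
    exact infinite_range_of_injective (A.pt_injective hA.isQuasiDual.arc_injective c)
  exact hinf (((toFinite {A.pt a 0, A.pt a 1}).image _).subset hsub)

end IsFractalGraph

/-! ### Lengths -/

/-- The total length of a set of translated edges. -/
noncomputable def length (v : E → ℝ) (X : Set (E × Plane)) : ℝ := ∑ᶠ a ∈ X, v a.1

theorem length_singleton (v : E → ℝ) (a : E × Plane) : length v {a} = v a.1 :=
  finsum_mem_singleton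

/-- A `finsum` has the default value 0 when infinitely many terms are nonzero, so finiteness
accompanies `length` throughout. -/
theorem length_union_le {v : E → ℝ} (hv : ∀ e, 0 ≤ v e) {X X' : Set (E × Plane)} (hX : X.Finite)
    (hX' : X'.Finite) : length v (X ∪ X') ≤ length v X + length v X' := by
  have h0 : 0 ≤ length v (X ∩ X') :=
    finsum_nonneg fun a => finsum_nonneg fun _ => hv a.1
  have := finsum_mem_union_inter (f := fun a : E × Plane => v a.1) hX hX'
  rw [length, length, length] at *
  linarith

theorem IsPerronFrobenius.length_subdiv_singleton [Fintype E] [DecidableEq E] {κ : ℝ} {v : E → ℝ}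
    (hPF : W.IsPerronFrobenius κ v) (a : E × Plane) :
    length v (W.subdiv {a}) = κ * v a.1 := by
  have hun : W.subdiv {a} = ⋃ f ∈ (univ : Set E), (fun z => (f, z + σ.lam ^ W.N • a.2)) ''
      W.edgeDigit a.1 f := by
    ext ⟨f, x⟩
    simp only [subdiv, mem_singleton_iff, exists_eq_left, mem_ofPred_eq, mem_univ, iUnion_true,
      mem_iUnion, mem_image, Prod.mk.injEq]
    constructor
    · intro h
      exact ⟨f, _, h, rfl, by simp⟩
    · rintro ⟨g, z, hz, rfl, rfl⟩
      simpa using hz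
  rw [length, hun, finsum_mem_biUnion]
  -- The row of $M^Ev=\kappa v$ at the edge `a.1`; its coefficients count the pieces of each type.
  · have heig := congrFun hPF.eigen a.1
    simp only [Matrix.mulVec, dotProduct, edgeMatrix, Matrix.of_apply, Pi.smul_apply,
      smul_eq_mul] at heig
    rw [← heig, finsum_mem_univ, finsum_eq_sum_of_fintype]
    refine Finset.sum_congr rfl fun f _ => ?_
    rw [finsum_mem_image (fun x _ y _ h => by simpa using h)]
    simp only
    rw [finsum_mem_eq_finite_toFinset_sum _ (W.edgeDigit_finite a.1 f), Finset.sum_const,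
      nsmul_eq_mul, ncard_eq_toFinset_card _ (W.edgeDigit_finite a.1 f)]
  · intro f _ g _ hfg
    rw [Function.onFun, Set.disjoint_left]
    rintro _ ⟨x, _, rfl⟩ ⟨y, _, h⟩
    exact hfg (congrArg Prod.fst h).symm
  · exact finite_univ
  · exact fun f _ => (W.edgeDigit_finite a.1 f).image _

theorem IsPerronFrobenius.length_subdiv [Fintype E] [DecidableEq E] {κ : ℝ} {v : E → ℝ}
    (hPF : W.IsPerronFrobenius κ v) (hA : W.IsFractalGraph A) (hfix : σ.FixesPrototiles) {p : ι}
    {X : Set (E × Plane)} (hX : X ⊆ A.tilingEdges σ p) (hfin : X.Finite) :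
    length v (W.subdiv X) = κ * length v X := by
  rw [subdiv_eq_biUnion, length, finsum_mem_biUnion, length,
    finsum_mem_eq_finite_toFinset_sum _ hfin, finsum_mem_eq_finite_toFinset_sum _ hfin,
    Finset.mul_sum]
  · exact Finset.sum_congr rfl fun a _ => hPF.length_subdiv_singleton a
  · intro a ha b hb hab
    exact hA.disjoint_subdiv hfix (hX ha) (hX hb) hab 1
  · exact hfin
  · exact fun a _ => finite_subdiv_singleton a

theorem IsPerronFrobenius.length_subdiv_iterate [Fintype E] [DecidableEq E] {κ : ℝ} {v : E → ℝ}
    (hPF : W.IsPerronFrobenius κ v) (hA : W.IsFractalGraph A) (hfix : σ.FixesPrototiles) {p : ι}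
    {X : Set (E × Plane)} (hX : X ⊆ A.tilingEdges σ p) (hfin : X.Finite) (n : ℕ) :
    length v (W.subdiv^[n] X) = κ ^ n * length v X := by
  induction n with
  | zero => simp
  | succ n ih =>
    rw [Function.iterate_succ_apply', hPF.length_subdiv hA hfix (hA.subdiv_iterate_subset hX n)
      (finite_subdiv_iterate hfin n), ih, pow_succ', mul_assoc]

end RecurrentPair

end Subdivision

end FractalTiling

namespace FractalTiling

/-! ### The edges of the fractal tree -/

namespace RecurrentPair

variable {ι E : Type*} {Pr : PrototileSet ι} {σ : Substitution Pr} {A : GeomGraph ι E}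
  {W : RecurrentPair σ E} {F₁ : ι → Set (E × Plane)}

/-- The copies of `F₁`, scaled by `lamᴺ`, in the supertiles `ωᴺ(t)` of the tiles `t ∈ T`. -/
def copies (W : RecurrentPair σ E) (F₁ : ι → Set (E × Plane)) (T : Set (Tile ι)) :
    Set (E × Plane) :=
  {c | ∃ t ∈ T, (c.1, c.2 - σ.lam ^ W.N • t.pos) ∈ F₁ t.label}

theorem copies_mono {T T' : Set (Tile ι)} (h : T ⊆ T') : W.copies F₁ T ⊆ W.copies F₁ T' := by
  rintro c ⟨t, ht, hc⟩
  exact ⟨t, h ht, hc⟩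

theorem mem_union_copies {T : Set (Tile ι)} {z : Plane} :
    z ∈ A.union (W.copies F₁ T) ↔
      ∃ t ∈ T, z - σ.lam ^ W.N • t.pos ∈ A.union (F₁ t.label) := by
  simp only [GeomGraph.mem_union, GeomGraph.mem_carrier]
  constructor
  · rintro ⟨c, ⟨t, ht, hc⟩, hz⟩
    exact ⟨t, ht, _, hc, by simpa using hz⟩
  · rintro ⟨t, ht, a, ha, hz⟩
    refine ⟨(a.1, a.2 + σ.lam ^ W.N • t.pos), ⟨t, ht, by simpa using ha⟩, ?_⟩
    simpa [sub_sub, add_comm] using hz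

theorem mem_iter_succ {i : ℕ} {p : ι} {t : Tile ι} :
    t ∈ σ.iter (W.N * (i + 1)) p ↔ ∃ s ∈ σ.iter W.N p,
      (⟨t.label, t.pos - (σ.lam ^ W.N) ^ i • s.pos⟩ : Tile ι) ∈ σ.iter (W.N * i) s.label := by
  rw [mul_add, mul_one, add_comm, Substitution.iter_add, Substitution.mem_onSet_iterate, pow_mul]

theorem mem_union_copies_iter_succ {i : ℕ} {p : ι} {z : Plane} :
    z ∈ A.union (W.copies F₁ (σ.iter (W.N * (i + 1)) p)) ↔
      ∃ s ∈ σ.iter W.N p, z - (σ.lam ^ W.N) ^ (i + 1) • s.pos ∈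
        A.union (W.copies F₁ (σ.iter (W.N * i) s.label)) := by
  simp only [mem_union_copies, mem_iter_succ]
  constructor
  · rintro ⟨t, ⟨s, hs, hts⟩, hz⟩
    refine ⟨s, hs, _, hts, ?_⟩
    rw [smul_sub, smul_smul, ← pow_succ', sub_sub_sub_cancel_right]
    exact hz
  · rintro ⟨s, hs, t, ht, hz⟩
    refine ⟨t.shift ((σ.lam ^ W.N) ^ i • s.pos), ⟨s, hs, by simpa [Tile.shift] using ht⟩, ?_⟩
    rw [sub_sub, add_comm, pow_succ', ← smul_smul, ← smul_add] at hz
    exact hz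

/-- The recursion for $F_{k+1}$, unfolded: at each of the $k$ steps one either applies $\mathcal
R^N$ or keeps the previous graph. Here `i` counts the former choices and `j` the latter; their order
does not matter. After inflation by $\mu^{k+1}$ what is left is the $\mu^j$-inflate of the copies of
$F_1$ over $\omega^{Ni}(p)$. -/
theorem mem_stage {k : ℕ} {p : ι} {y : Plane} :
    y ∈ W.stage A F₁ k p ↔ ∃ i j, i + j = k ∧ (σ.lam ^ W.N) ^ (k + 1) • y ∈
      (σ.lam ^ W.N) ^ j • A.union (W.copies F₁ (σ.iter (W.N * i) p)) := by
  have hμ := W.scale_pos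
  induction k generalizing p y with
  | zero =>
    have h0 : W.copies F₁ (σ.iter 0 p) = F₁ p := by
      ext c
      simp [copies, Substitution.iter, Tile.ofProto]
    simp only [stage, subCarrier, mem_iUnion, exists_prop, Nat.add_eq_zero_iff,
      mem_smul_set_iff_inv_smul_mem₀ (inv_ne_zero hμ.ne'), inv_inv]
    constructor
    · rintro ⟨a, ha, hy⟩
      exact ⟨0, 0, ⟨rfl, rfl⟩, by simpa [h0] using GeomGraph.mem_union.2 ⟨a, ha, hy⟩⟩
    · rintro ⟨i, j, ⟨rfl, rfl⟩, hy⟩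
      exact GeomGraph.mem_union.1 (by simpa [h0] using hy)
  | succ k ih =>
    simp only [mem_smul_set_iff_inv_smul_mem₀ (pow_pos hμ _).ne'] at ih ⊢
    simp only [stage, mem_union, Substitution.contract, mem_iUnion, exists_prop,
      mem_smul_set_iff_inv_smul_mem₀ (inv_ne_zero hμ.ne'), inv_inv,
      mem_vadd_set_iff_neg_vadd_mem, vadd_eq_add, neg_add_eq_sub, ih]
    have hpow : ∀ i j : ℕ, i + j = k → ((σ.lam ^ W.N) ^ j)⁻¹ * (σ.lam ^ W.N) ^ (k + 1) =
        (σ.lam ^ W.N) ^ (i + 1) := by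
      rintro i j rfl
      rw [inv_mul_eq_iff_eq_mul₀ (pow_pos hμ _).ne', ← pow_add]
      congr 1
      omega
    have hpow' : ∀ i j : ℕ, i + j = k → ((σ.lam ^ W.N) ^ j)⁻¹ * (σ.lam ^ W.N) ^ (k + 1 + 1) =
        (σ.lam ^ W.N) ^ (i + 1 + 1) := by
      rintro i j rfl
      rw [inv_mul_eq_iff_eq_mul₀ (pow_pos hμ _).ne', ← pow_add]
      congr 1
      omega
    have hpow'' : ∀ j : ℕ, ((σ.lam ^ W.N) ^ (j + 1))⁻¹ * (σ.lam ^ W.N) ^ (k + 1 + 1) =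
        ((σ.lam ^ W.N) ^ j)⁻¹ * (σ.lam ^ W.N) ^ (k + 1) := by
      intro j
      rw [pow_succ, pow_succ _ (k + 1), mul_inv]
      field_simp
    constructor
    · rintro (⟨q, x, hx, i, j, hij, hy⟩ | ⟨i, j, hij, hy⟩)
      · refine ⟨i + 1, j, by omega, mem_union_copies_iter_succ.2 ⟨⟨q, x⟩, hx, ?_⟩⟩
        rw [smul_smul, hpow i j hij, smul_sub, smul_smul, ← pow_succ] at hy
        rw [smul_smul, hpow' i j hij]
        exact hy
      · refine ⟨i, j + 1, by omega, ?_⟩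
        rw [smul_smul, hpow'', ← smul_smul]
        exact hy
    · rintro ⟨i, j, hij, hy⟩
      -- If `j` is positive, the last step may be taken to be a keeping step; if it is 0, all steps
      -- are contractions.
      rcases Nat.eq_zero_or_pos j with hj | hj
      · obtain ⟨i, rfl⟩ : ∃ i', i = i' + 1 := ⟨k, by omega⟩
        obtain ⟨s, hs, hy⟩ := mem_union_copies_iter_succ.1 hy
        refine Or.inl ⟨s.label, s.pos, hs, i, j, by omega, ?_⟩
        rw [smul_smul, hpow i j (by omega), smul_sub, smul_smul, ← pow_succ]
        rw [smul_smul, hpow' i j (by omega)] at hy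
        exact hy
      · obtain ⟨j, rfl⟩ : ∃ j', j = j' + 1 := ⟨j - 1, by omega⟩
        refine Or.inr ⟨i, j, by omega, ?_⟩
        rw [smul_smul, hpow'', ← smul_smul] at hy
        exact hy

/-- Only `j` survives in the limit: the supertiles $\omega^{Ni}(p)$ exhaust $T_p$ and `i` is
unrestricted. -/
theorem mem_treeBody (hfix : σ.FixesPrototiles) {p : ι} {y : Plane} :
    y ∈ W.treeBody A F₁ p ↔
      ∃ j : ℕ, y ∈ (σ.lam ^ W.N) ^ j • A.union (W.copies F₁ (σ.tiling p)) := by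
  have hμ := W.scale_pos
  simp only [treeBody, mem_iUnion, pow_mul, mem_smul_set_iff_inv_smul_mem₀ (pow_pos hμ _).ne',
    mem_stage, smul_inv_smul₀ (pow_pos hμ _).ne']
  constructor
  · rintro ⟨k, i, j, -, hy⟩
    exact ⟨j, biUnion_subset_biUnion_left (copies_mono (subset_iUnion _ _)) hy⟩
  · rintro ⟨j, hy⟩
    obtain ⟨c, ⟨t, ht, hc⟩, hy⟩ := GeomGraph.mem_union.1 hy
    obtain ⟨i, hi⟩ := (Substitution.mem_tiling_iff hfix W.N_pos).1 ht
    exact ⟨i + j, i, j, rfl, GeomGraph.mem_union.2 ⟨c, ⟨t, hi, hc⟩, hy⟩⟩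

namespace IsFirstTree

theorem copies_subset (hF : W.IsFirstTree A F₁) (p : ι) :
    W.copies F₁ (σ.tiling p) ⊆ A.tilingEdges σ p := by
  rintro c ⟨t, ht, hc⟩
  have := Substitution.mem_tiling_of_mem_iter ht (hF.subset _ hc)
  change A.tile c ∈ σ.tiling p
  simpa [GeomGraph.tile] using this

theorem finite [Finite E] (hF : W.IsFirstTree A F₁) (p : ι) : (F₁ p).Finite := by
  refine Finite.subset ?_ (hF.subset p)
  refine (finite_iUnion fun e : E => ((Substitution.finite_iter (σ := σ) W.N p).image
    fun t => (e, t.pos))).subset fun a ha => ?_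
  exact mem_iUnion.2 ⟨a.1, A.tile a, ha, rfl⟩

end IsFirstTree

theorem treeEdges_subset (p : ι) : W.treeEdges A F₁ p ⊆ A.tilingEdges σ p := fun _ h => h.1

theorem IsFractalGraph.subdiv_copies_subset (hA : W.IsFractalGraph A)
    (hfix : σ.FixesPrototiles) (hF : W.IsFirstTree A F₁) (p : ι) (j : ℕ) :
    W.subdiv^[j] (W.copies F₁ (σ.tiling p)) ⊆ W.treeEdges A F₁ p := by
  intro c hc
  refine ⟨hA.subdiv_iterate_subset (hF.copies_subset p) j hc, fun y hy => ?_⟩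
  rw [mem_treeBody hfix]
  refine ⟨j, ?_⟩
  rw [← hA.union_subdiv_iterate]
  exact GeomGraph.carrier_subset_union hc hy

/-- The tree is defined as a point set; this gives each of its edges a level `j`. The midpoint of
the edge lies on an edge of some level, and by noncrossing the two edges coincide. -/
theorem IsFractalGraph.exists_mem_subdiv_copies (hA : W.IsFractalGraph A)
    (hfix : σ.FixesPrototiles) (hF : W.IsFirstTree A F₁) {p : ι} {a : E × Plane}
    (ha : a ∈ W.treeEdges A F₁ p) : ∃ j, a ∈ W.subdiv^[j] (W.copies F₁ (σ.tiling p)) := by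
  obtain ⟨j, hj⟩ := (mem_treeBody hfix).1 (ha.2 (A.pt_mem_carrier a GeomGraph.mid))
  rw [← hA.union_subdiv_iterate] at hj
  obtain ⟨b, hb, hab⟩ := GeomGraph.mem_union.1 hj
  refine ⟨j, ?_⟩
  rwa [(hA.isQuasiDual.noncrossing hfix p).eq_of_mid_mem (treeEdges_subset p ha)
    (hA.subdiv_iterate_subset (hF.copies_subset p) j hb) hab]

end RecurrentPair

end FractalTiling

namespace FractalTiling

/-! ### Upper bound for the fractal distance -/

/-- Pruning the walk to a path yields the unique path. -/
theorem edges_subset_of_isAcyclic {V : Type*} {G : SimpleGraph V} (hG : G.IsAcyclic) {u w : V}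
    {p : G.Walk u w} (hp : p.IsPath) (q : G.Walk u w) : p.edges ⊆ q.edges := by
  classical
  have : (⟨p, hp⟩ : G.Path u w) = q.toPath := (hG.subsingleton_path u w).elim _ _
  have h2 : p = (q.toPath : G.Walk u w) := congrArg Subtype.val this
  rw [h2]
  exact q.edges_toPath_subset_edges

namespace RecurrentPair

variable {ι E : Type*} {Pr : PrototileSet ι} {σ : Substitution Pr} {A : GeomGraph ι E}
  {W : RecurrentPair σ E} {F₁ : ι → Set (E × Plane)} {v : E → ℝ} {p : ι}

namespace IsFractalTree

theorem edgeLength_ends (hF : W.IsFractalTree A F₁ p) {a : E × Plane}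
    (ha : a ∈ W.treeEdges A F₁ p) : W.edgeLength A F₁ v p (A.ends a) = v a.1 := by
  have : {b ∈ W.treeEdges A F₁ p | A.ends b = A.ends a} = {a} := by
    ext b
    constructor
    · rintro ⟨hb, hba⟩
      exact hF.isTree.simple b hb a ha hba
    · rintro rfl
      exact ⟨ha, rfl⟩
  rw [edgeLength, this, finsum_mem_singleton]

theorem fractalDist_eq (hF : W.IsFractalTree A F₁ p) {t t' : Tile ι}
    {w : (A.graph (W.treeEdges A F₁ p)).Walk t.pos t'.pos} (hw : w.IsPath) :
    W.fractalDist A F₁ v p t t' = (w.edges.map (W.edgeLength A F₁ v p)).sum := by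
  have := hF.isTree.acyclic.subsingleton_path t.pos t'.pos
  exact ciInf_subsingleton (⟨w, hw⟩ : (A.graph (W.treeEdges A F₁ p)).Path t.pos t'.pos) _

theorem sum_edgeLength (hF : W.IsFractalTree A F₁ p) {Z : Set (E × Plane)}
    (hZ : Z ⊆ W.treeEdges A F₁ p) (hfin : Z.Finite) [DecidableEq (Sym2 Plane)] :
    ∑ z ∈ hfin.toFinset.image A.ends, W.edgeLength A F₁ v p z = length v Z := by
  rw [Finset.sum_image, length, finsum_mem_eq_finite_toFinset_sum _ hfin]
  · exact Finset.sum_congr rfl fun a ha => hF.edgeLength_ends (hZ (hfin.mem_toFinset.1 ha))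
  · intro a ha b hb hab
    exact hF.isTree.simple a (hZ (by simpa using ha)) b (hZ (by simpa using hb)) hab

theorem edgeLength_nonneg (hv : ∀ e, 0 ≤ v e) (z : Sym2 Plane) :
    0 ≤ W.edgeLength A F₁ v p z := finsum_nonneg fun a => finsum_nonneg fun _ => hv a.1

theorem fractalDist_le (hF : W.IsFractalTree A F₁ p) (hv : ∀ e, 0 ≤ v e) {Z : Set (E × Plane)}
    (hZ : Z ⊆ W.treeEdges A F₁ p) (hfin : Z.Finite) {t t' : Tile ι}
    (h : (A.graph Z).Reachable t.pos t'.pos) : W.fractalDist A F₁ v p t t' ≤ length v Z := by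
  classical
  obtain ⟨w, hw⟩ := h.exists_isPath
  have hle := GeomGraph.graph_mono (A := A) hZ
  rw [hF.fractalDist_eq ((SimpleGraph.Walk.isPath_mapLe hle).2 hw),
    SimpleGraph.Walk.edges_mapLe_eq_edges, ← List.sum_toFinset _ hw.isTrail.edges_nodup,
    ← hF.sum_edgeLength hZ hfin]
  refine Finset.sum_le_sum_of_subset_of_nonneg (fun z hz => ?_)
    fun z _ _ => edgeLength_nonneg hv z
  obtain ⟨a, ha, rfl⟩ := GeomGraph.exists_ends_of_mem_edgeSet
    (w.edges_subset_edgeSet (List.mem_toFinset.1 hz))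
  exact Finset.mem_image_of_mem _ (hfin.mem_toFinset.2 ha)

theorem le_fractalDist (hF : W.IsFractalTree A F₁ p) (hv : ∀ e, 0 ≤ v e) {Z : Set (E × Plane)}
    (hZ : Z ⊆ W.treeEdges A F₁ p) (hfin : Z.Finite) {t t' : Tile ι}
    {w : (A.graph (W.treeEdges A F₁ p)).Walk t.pos t'.pos} (hw : w.IsPath)
    (h : ∀ a ∈ Z, A.ends a ∈ w.edges) : length v Z ≤ W.fractalDist A F₁ v p t t' := by
  classical
  rw [hF.fractalDist_eq hw, ← List.sum_toFinset _ hw.isTrail.edges_nodup,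
    ← hF.sum_edgeLength hZ hfin]
  refine Finset.sum_le_sum_of_subset_of_nonneg (fun z hz => ?_)
    fun z _ _ => edgeLength_nonneg hv z
  obtain ⟨a, ha, rfl⟩ := Finset.mem_image.1 hz
  exact List.mem_toFinset.2 (h a (hfin.mem_toFinset.1 ha))

end IsFractalTree

theorem copies_singleton (u : Tile ι) :
    W.copies F₁ {u} = (fun a => (a.1, a.2 + σ.lam ^ W.N • u.pos)) '' F₁ u.label := by
  ext c
  constructor
  · rintro ⟨t, rfl, hc⟩
    exact ⟨_, hc, by simp⟩
  · rintro ⟨a, ha, rfl⟩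
    exact ⟨u, rfl, by simpa using ha⟩

theorem reachable_copies (u : Tile ι) {x y : Plane} (h : (A.graph (F₁ u.label)).Reachable x y) :
    (A.graph (W.copies F₁ {u})).Reachable (x + σ.lam ^ W.N • u.pos)
      (y + σ.lam ^ W.N • u.pos) := by
  obtain ⟨q⟩ := h
  induction q with
  | nil => exact .refl _
  | cons hadj q ih =>
    refine SimpleGraph.Reachable.trans ?_ ih
    obtain ⟨a, ha, hends⟩ := GeomGraph.exists_ends_of_adj hadj
    have hmem : (a.1, a.2 + σ.lam ^ W.N • u.pos) ∈ W.copies F₁ {u} := by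
      rw [copies_singleton]
      exact mem_image_of_mem _ ha
    have hmap : A.ends (a.1, a.2 + σ.lam ^ W.N • u.pos) =
        (A.ends a).map (· + σ.lam ^ W.N • u.pos) := by
      simp [GeomGraph.ends, add_right_comm]
    refine GeomGraph.reachable_of_mem_ends hmem ?_ ?_
    · rw [hmap, hends]
      exact Sym2.mem_mk_left _ _
    · rw [hmap, hends]
      exact Sym2.mem_mk_right _ _

theorem length_copies_singleton (u : Tile ι) :
    length v (W.copies F₁ {u}) = length v (F₁ u.label) := by
  rw [copies_singleton, length, finsum_mem_image]
  · rfl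
  · rintro ⟨e, x⟩ _ ⟨f, y⟩ _ h
    simpa using h

theorem IsFractalGraph.subdiv_treeEdges_subset (hA : W.IsFractalGraph A)
    (hfix : σ.FixesPrototiles) (hF : W.IsFirstTree A F₁) :
    W.subdiv (W.treeEdges A F₁ p) ⊆ W.treeEdges A F₁ p := by
  intro c hc
  obtain ⟨a, ha, hca⟩ := mem_subdiv_singletons.1 hc
  obtain ⟨j, hj⟩ := hA.exists_mem_subdiv_copies hfix hF ha
  refine hA.subdiv_copies_subset hfix hF p (j + 1) ?_
  rw [Function.iterate_succ_apply']
  exact mem_subdiv_singletons.2 ⟨a, hj, hca⟩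

/-- Let `s` lie in the supertile $\omega^N(u)$. The copy of $F_1$ there joins $x(s)$ to $\mu\,x(u)$,
which is also a puncture because $\omega$ fixes prototiles. The subdivided route of `u` leads on
from $\mu\,x(u)$ to 0. The lengths satisfy $\ell_{n+1}\le L+\kappa\ell_n$, $\ell_0=0$, whence the
geometric sum. -/
theorem exists_connecting_edges [Finite ι] [Fintype E] [DecidableEq E] {κ : ℝ}
    (hfix : σ.FixesPrototiles) (hPF : W.IsPerronFrobenius κ v) (hA : W.IsFractalGraph A)
    (hF : W.IsFirstTree A F₁) {L : ℝ} (hL : ∀ q, length v (F₁ q) ≤ L) (n : ℕ) (s : Tile ι)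
    (hs : s ∈ σ.iter (W.N * n) p) : ∃ Z ⊆ W.treeEdges A F₁ p, Z.Finite ∧
      (A.graph Z).Reachable s.pos 0 ∧ length v Z ≤ L * (κ ^ n - 1) / (κ - 1) := by
  have hκ : 0 < κ - 1 := sub_pos.2 hPF.one_lt
  have hv : ∀ e, 0 ≤ v e := fun e => (hPF.pos e).le
  induction n generalizing s with
  | zero =>
    rw [mul_zero] at hs
    obtain rfl : s = Tile.ofProto p := hs
    exact ⟨∅, empty_subset _, finite_empty, .refl _, by simp [length]⟩
  | succ n ih =>
    rw [mul_add, mul_one, Substitution.iter_add, Substitution.mem_onSet_iterate] at hs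
    obtain ⟨u, hu, hs⟩ := hs
    obtain ⟨Z, hZ, hfin, hreach, hlen⟩ := ih u hu
    have huT : u ∈ σ.tiling p := mem_iUnion.2 ⟨_, hu⟩
    have hcfin : (W.copies F₁ {u}).Finite := by
      rw [copies_singleton]
      exact (hF.finite _).image _
    refine ⟨W.copies F₁ {u} ∪ W.subdiv Z, union_subset ?_ ?_, hcfin.union (finite_subdiv hfin),
      SimpleGraph.Reachable.trans (v := σ.lam ^ W.N • u.pos) ?_ ?_, ?_⟩
    · exact (copies_mono (singleton_subset_iff.2 huT)).trans
        (hA.subdiv_copies_subset hfix hF p 0)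
    · exact (subdiv_mono hZ).trans (hA.subdiv_treeEdges_subset hfix hF)
    · refine SimpleGraph.Reachable.mono (GeomGraph.graph_mono subset_union_left) ?_
      have h0 : (0 : Plane) ∈ A.verts (F₁ u.label) :=
        hF.puncture u.label _ (Substitution.ofProto_mem_iter hfix W.N u.label)
      have := reachable_copies (W := W) u
        ((hF.isTree u.label).connected _ (hF.puncture u.label _ hs) 0 h0)
      simpa using this
    · refine SimpleGraph.Reachable.mono (GeomGraph.graph_mono subset_union_right) ?_
      have := hA.reachable_subdiv hfix (hZ.trans (treeEdges_subset p)) 1 hreach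
      simpa using this
    · refine (length_union_le hv hcfin (finite_subdiv hfin)).trans ?_
      rw [length_copies_singleton,
        hPF.length_subdiv hA hfix (hZ.trans (treeEdges_subset p)) hfin]
      calc length v (F₁ u.label) + κ * length v Z
          ≤ L + κ * (L * (κ ^ n - 1) / (κ - 1)) := by
            have := hPF.one_lt
            gcongr
            exact hL _
        _ = L * (κ ^ (n + 1) - 1) / (κ - 1) := by
            field_simp
            ring

/-- The tiles of the supertile `ω^(N n)(p)` have fractal distance at most `C κⁿ` from `p`. -/
theorem exists_fractalDist_le [Finite ι] [Fintype E] [DecidableEq E] {κ : ℝ}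
    (hfix : σ.FixesPrototiles) (hPF : W.IsPerronFrobenius κ v) (hA : W.IsFractalGraph A)
    (hF : W.IsFractalTree A F₁ p) : ∃ C > 0, ∀ n, ∀ s ∈ σ.iter (W.N * n) p,
      W.fractalDist A F₁ v p s (Tile.ofProto p) ≤ C * κ ^ n := by
  have hκ : 0 < κ - 1 := sub_pos.2 hPF.one_lt
  have hv : ∀ e, 0 ≤ v e := fun e => (hPF.pos e).le
  obtain ⟨L, hL⟩ := (finite_range fun q => length v (F₁ q)).bddAbove
  -- The maximum with 1 only serves to make the constant positive.
  have hL' : ∀ q, length v (F₁ q) ≤ max L 1 := fun q =>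
    (hL (mem_range_self q)).trans (le_max_left _ _)
  have hpos : 0 < max L 1 := zero_lt_one.trans_le (le_max_right _ _)
  refine ⟨max L 1 / (κ - 1), div_pos hpos hκ, fun n s hs => ?_⟩
  obtain ⟨Z, hZ, hfin, hreach, hlen⟩ :=
    exists_connecting_edges hfix hPF hA hF.isFirstTree hL' n s hs
  refine (hF.fractalDist_le hv hZ hfin hreach).trans (hlen.trans ?_)
  rw [div_mul_eq_mul_div]
  gcongr
  linarith

end RecurrentPair

end FractalTiling

namespace FractalTiling

/-! ### Lower bound for the fractal distance -/

section LowerBound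

variable {ι E : Type*} {Pr : PrototileSet ι} {σ : Substitution Pr} {A : GeomGraph ι E}
  {W : RecurrentPair σ E} {F₁ : ι → Set (E × Plane)} {v : E → ℝ} {p : ι}

theorem GeomGraph.mem_edgesOf_ofProto {a : E × Plane} :
    a ∈ A.edgesOf (Tile.ofProto p) ↔ A.host a.1 = p ∧ a.2 = 0 := by
  simp [GeomGraph.edgesOf, GeomGraph.tile, Tile.ofProto]

theorem GeomGraph.IsQuasiDual.eq_of_mem_frontier (h : A.IsQuasiDual σ) {a b : E × Plane}
    (ha : a ∈ A.edgesOf (Tile.ofProto p)) (hb : b ∈ A.edgesOf (Tile.ofProto p)) {y : Plane}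
    (hya : y ∈ A.carrier a) (hyb : y ∈ A.carrier b) (hy : y ∈ frontier (Pr.supp p)) : a = b := by
  obtain ⟨rfl, ha2⟩ := GeomGraph.mem_edgesOf_ofProto.1 ha
  obtain ⟨hab, hb2⟩ := GeomGraph.mem_edgesOf_ofProto.1 hb
  obtain ⟨s, hs⟩ := GeomGraph.mem_carrier.1 hya
  obtain ⟨s', hs'⟩ := GeomGraph.mem_carrier.1 hyb
  rw [ha2, sub_zero] at hs
  rw [hb2, sub_zero] at hs'
  exact Prod.ext (h.leaf a.1 b.1 hab.symm s s' (hs.trans hs'.symm) (hs ▸ hy))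
    (ha2.trans hb2.symm)

/-- A path in the tree in a prototile ending at an interior vertex visits no boundary vertex after
its first step. -/
theorem GeomGraph.IsQuasiDual.notMem_frontier (h : A.IsQuasiDual σ) {u u' w : Plane}
    (hadj : (A.graph (A.edgesOf (Tile.ofProto p))).Adj u u')
    (q : (A.graph (A.edgesOf (Tile.ofProto p))).Walk u' w) (hw : w ∉ frontier (Pr.supp p))
    (hq : (SimpleGraph.Walk.cons hadj q).IsPath) : ∀ y ∈ q.support, y ∉ frontier (Pr.supp p) := by
  induction q generalizing u with
  | nil => simpa using hw
  | @cons u' u'' w hadj' q ih =>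
    intro y hy
    rw [SimpleGraph.Walk.support_cons, List.mem_cons] at hy
    rcases hy with rfl | hy
    · intro hfr
      obtain ⟨a, ha, hae⟩ := GeomGraph.exists_ends_of_adj hadj
      obtain ⟨b, hb, hbe⟩ := GeomGraph.exists_ends_of_adj hadj'
      have hya : y ∈ A.ends a := hae ▸ Sym2.mem_mk_right _ _
      have hyb : y ∈ A.ends b := hbe ▸ Sym2.mem_mk_left _ _
      -- A boundary vertex has degree one, so the path would leave `y` by the edge on which it came
      -- and return to `u`.
      have hab := h.eq_of_mem_frontier ha hb (GeomGraph.mem_carrier_of_mem_ends hya)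
        (GeomGraph.mem_carrier_of_mem_ends hyb) hfr
      rw [hab, hbe, Sym2.eq_swap, Sym2.congr_left] at hae
      rw [SimpleGraph.Walk.cons_isPath_iff] at hq
      refine hq.2 ?_
      rw [← hae, SimpleGraph.Walk.support_cons]
      exact List.mem_cons_of_mem _ q.start_mem_support
    · exact ih hadj' hw hq.of_cons y hy

/-- The edges in the prototile `p` without endpoint on its boundary. -/
def GeomGraph.innerEdges (A : GeomGraph ι E) (Pr : PrototileSet ι) (p : ι) : Set (E × Plane) :=
  {a ∈ A.edgesOf (Tile.ofProto p) | ∀ u ∈ A.ends a, u ∉ frontier (Pr.supp p)}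

theorem PrototileSet.notMem_frontier_of_mem_interior {y : Plane}
    (hy : y ∈ interior (Pr.supp p)) : y ∉ frontier (Pr.supp p) := fun h => h.2 hy

/-- The edge at a boundary vertex is connected with the puncture by inner edges. -/
theorem GeomGraph.IsQuasiDual.exists_reachable (h : A.IsQuasiDual σ) {g : E × Plane}
    (hg : g ∈ A.edgesOf (Tile.ofProto p)) {b : Plane} (hb : b ∈ A.ends g)
    (hfr : b ∈ frontier (Pr.supp p)) :
    ∃ u, A.ends g = s(b, u) ∧ (A.graph (A.innerEdges Pr p)).Reachable u 0 := by
  have h0 : (0 : Plane) ∉ frontier (Pr.supp p) :=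
    Pr.notMem_frontier_of_mem_interior (Pr.zero_mem_interior p)
  obtain ⟨q, hq⟩ := ((h.isTree p).connected b ⟨g, hg, hb⟩ 0 (h.puncture p)).exists_isPath
  cases q with
  | nil => exact absurd hfr h0
  | @cons _ u _ hadj q =>
    obtain ⟨a, ha, hae⟩ := GeomGraph.exists_ends_of_adj hadj
    have hba : b ∈ A.ends a := hae ▸ Sym2.mem_mk_left _ _
    have hag := h.eq_of_mem_frontier ha hg (GeomGraph.mem_carrier_of_mem_ends hba)
      (GeomGraph.mem_carrier_of_mem_ends hb) hfr
    refine ⟨u, hag ▸ hae, ⟨q.transfer _ fun z hz => ?_⟩⟩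
    have hsupp := h.notMem_frontier hadj q h0 hq
    have hzG := q.edges_subset_edgeSet hz
    obtain ⟨c, hc, rfl⟩ := GeomGraph.exists_ends_of_mem_edgeSet hzG
    rw [GeomGraph.graph, SimpleGraph.edgeSet_fromEdgeSet] at hzG ⊢
    refine ⟨mem_image_of_mem _ ⟨hc, fun y hy => hsupp y ?_⟩, hzG.2⟩
    exact SimpleGraph.Walk.mem_support_of_mem_edges hz hy

namespace RecurrentPair

/-- Links $A_p$ with $F_1$: a piece of an inner edge touches the boundary of $p$ nowhere, because
the edge could meet it only in an endpoint. Hence it is among the edges that $F_1$ must contain. -/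
theorem IsFractalGraph.subdiv_innerEdges_subset (hA : W.IsFractalGraph A)
    (hF : W.IsFirstTree A F₁) : W.subdiv (A.innerEdges Pr p) ⊆ F₁ p := by
  refine Subset.trans ?_ (hF.contains p)
  intro c hc
  obtain ⟨a, ha, hca⟩ := mem_subdiv_singletons.1 hc
  obtain ⟨hhost, ha2⟩ := GeomGraph.mem_edgesOf_ofProto.1 ha.1
  have hsub : W.subCarrier A c ⊆ A.carrier a := by
    have := hA.carrier_subset_of_mem_subdiv (n := 1) hca
    rw [pow_one] at this
    intro y hy
    have hy' := this ((mem_smul_set_iff_inv_smul_mem₀ (inv_ne_zero W.scale_pos.ne') _ _).1 hy)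
    rw [mem_smul_set_iff_inv_smul_mem₀ W.scale_pos.ne', inv_inv,
      inv_smul_smul₀ W.scale_pos.ne'] at hy'
    exact hy'
  refine ⟨?_, ?_, fun u hu hfr => ?_⟩
  · obtain ⟨b, rfl, hd⟩ := hca
    have := hd.1
    rw [ha2, smul_zero, sub_zero, ← hA.host_eq, hhost] at this
    exact this
  · intro y hy
    have hya := GeomGraph.mem_carrier.1 (hsub hy)
    rw [ha2, sub_zero] at hya
    exact mem_biUnion (show a.1 ∈ {e | A.host e = p} from hhost) hya
  · have hua : (σ.lam ^ W.N)⁻¹ • u ∈ A.carrier a :=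
      hsub (smul_mem_smul_set (GeomGraph.mem_carrier_of_mem_ends hu))
    rw [GeomGraph.carrier_eq_range] at hua
    obtain ⟨s, hs⟩ := hua
    have hs2 : A.arc a.1 s = (σ.lam ^ W.N)⁻¹ • u := by
      rw [← A.pt_sub a s, hs, ha2, sub_zero]
    refine ha.2 _ (hs ▸ GeomGraph.pt_mem_ends (hA.isQuasiDual.boundary a.1 s ?_)) hfr
    rw [hs2, hhost]
    exact hfr

theorem IsFractalGraph.ends_mem_edges (hA : W.IsFractalGraph A) (hfix : σ.FixesPrototiles)
    {a : E × Plane} (ha : a ∈ A.tilingEdges σ p) {u w : Plane} (hends : A.ends a = s(u, w))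
    {n : ℕ}
    (q : (A.graph (W.subdiv^[n] {a})).Walk ((σ.lam ^ W.N) ^ n • u) ((σ.lam ^ W.N) ^ n • w))
    {c : E × Plane} (hc : c ∈ W.subdiv^[n] {a}) : A.ends c ∈ q.edges := by
  have hinj := hA.isQuasiDual.arc_injective
  have hnc : A.Noncrossing (W.subdiv^[n] {a}) := (hA.isQuasiDual.noncrossing hfix p).mono
    (hA.subdiv_iterate_subset (singleton_subset_iff.2 ha) n)
  have key := fun q => hnc.ends_mem_edges hinj (IsFractalGraph.continuous_smul_pt (W := W) a n)
    (IsFractalGraph.smul_pt_injective hinj a n) (hA.range_smul_pt a n) q hc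
  rw [GeomGraph.ends_eq, Sym2.eq_iff] at hends
  rcases hends with ⟨rfl, rfl⟩ | ⟨rfl, rfl⟩
  · exact key q
  · have := key q.reverse
    rwa [SimpleGraph.Walk.edges_reverse, List.mem_reverse] at this

/-- A walk in the fractal tree from the puncture of `p` to a boundary point of the supertile
`ω^(N (n + 1))(p)` passes along the whole inflated edge of `A` at this boundary point. -/
theorem IsFractalTree.ends_mem_edges [Finite E] (hF : W.IsFractalTree A F₁ p)
    (hA : W.IsFractalGraph A) (hfix : σ.FixesPrototiles) {g : E × Plane}
    (hg : g ∈ A.edgesOf (Tile.ofProto p)) {b : Plane} (hb : b ∈ A.ends g)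
    (hfr : b ∈ frontier (Pr.supp p)) {n : ℕ}
    (hsub : W.subdiv^[n + 1] {g} ⊆ W.treeEdges A F₁ p)
    (P : (A.graph (W.treeEdges A F₁ p)).Walk 0 ((σ.lam ^ W.N) ^ (n + 1) • b))
    {c : E × Plane} (hc : c ∈ W.subdiv^[n + 1] {g}) : A.ends c ∈ P.edges := by
  have hpT := Substitution.ofProto_mem_tiling (σ := σ) p
  have hof : A.edgesOf (Tile.ofProto p) ⊆ A.tilingEdges σ p := by
    intro a ha
    change A.tile a ∈ σ.tiling p
    rwa [show A.tile a = Tile.ofProto p from ha]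
  have hin : A.innerEdges Pr p ⊆ A.tilingEdges σ p := (sep_subset _ _).trans hof
  have hinT : W.subdiv^[n + 1] (A.innerEdges Pr p) ⊆ W.treeEdges A F₁ p := by
    -- One subdivision brings the inner edges into $F_1$, the other `n` keep them in the tree; hence
    -- the exponent `n + 1`.
    rw [Function.iterate_succ_apply]
    refine (subdiv_iterate_mono ?_ n).trans (hA.subdiv_copies_subset hfix hF.isFirstTree p n)
    refine (hA.subdiv_innerEdges_subset hF.isFirstTree).trans fun a ha => ?_
    exact ⟨_, hpT, by simpa [Tile.ofProto] using ha⟩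
  obtain ⟨u, hends, hreach⟩ := hA.isQuasiDual.exists_reachable hg hb hfr
  obtain ⟨W₁⟩ := hA.reachable_subdiv hfix hin (n + 1) hreach
  obtain ⟨W₂, hW₂⟩ := (hA.reachable_subdiv hfix (singleton_subset_iff.2 (hof hg)) (n + 1)
    (GeomGraph.reachable_of_mem_ends (mem_singleton g) (hends ▸ Sym2.mem_mk_right _ _)
      (hends ▸ Sym2.mem_mk_left _ _) : (A.graph {g}).Reachable u b)).exists_isPath
  have hle₁ := GeomGraph.graph_mono (A := A) hinT
  have hle₂ := GeomGraph.graph_mono (A := A) hsub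
  have hcW₂ : A.ends c ∈ W₂.edges :=
    hA.ends_mem_edges hfix (hof hg) (hends.trans Sym2.eq_swap) W₂ hc
  -- Two ways from the inflate of `u` to that of `b`: the path `W₂` along the inflated `g`, and the
  -- detour through 0 by `W₁` and `P`. In a tree the detour contains all edges of `W₂`.
  have hsubset := edges_subset_of_isAcyclic hF.isTree.acyclic
    ((SimpleGraph.Walk.isPath_mapLe hle₂).2 hW₂)
    (((W₁.mapLe hle₁).copy rfl (smul_zero _)).append P)
  rw [SimpleGraph.Walk.edges_mapLe_eq_edges, SimpleGraph.Walk.edges_append,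
    SimpleGraph.Walk.edges_copy, SimpleGraph.Walk.edges_mapLe_eq_edges] at hsubset
  rcases List.mem_append.1 (hsubset hcW₂) with hc₁ | hcP
  -- `W₁` runs along inflated inner edges, and different edges have no common pieces; so the edge
  -- must come from `P`.
  · exfalso
    obtain ⟨d, hd, hdc⟩ := GeomGraph.exists_ends_of_mem_edgeSet (W₁.edges_subset_edgeSet hc₁)
    obtain rfl := hF.isTree.simple d (hinT hd) c (hsub hc) hdc
    obtain ⟨a, ha, hda⟩ := mem_subdiv_iterate_singletons.1 hd
    have hag : a ≠ g := by
      rintro rfl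
      exact ha.2 b hb hfr
    exact Set.disjoint_left.1 (hA.disjoint_subdiv hfix (hin ha) (hof hg) hag (n + 1)) hda hc
  · exact hcP

/-- The point where a walk in the fractal tree leaves the supertile `ω^(N (n + 1))(p)`. -/
theorem IsFractalTree.exists_exit (hF : W.IsFractalTree A F₁ p)
    (hA : W.IsFractalGraph A) (hfix : σ.FixesPrototiles) {n : ℕ} {a : E × Plane}
    (ha : a ∈ W.treeEdges A F₁ p) {y y' : Plane} (hy : y ∈ A.carrier a) (hy' : y' ∈ A.carrier a)
    (hyK : y ∈ interior ((σ.lam ^ W.N) ^ (n + 1) • Pr.supp p))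
    (hyK' : y' ∉ interior ((σ.lam ^ W.N) ^ (n + 1) • Pr.supp p)) :
    ∃ g ∈ A.edgesOf (Tile.ofProto p), ∃ b ∈ A.ends g, b ∈ frontier (Pr.supp p) ∧
      W.subdiv^[n + 1] {g} ⊆ W.treeEdges A F₁ p ∧ y' = (σ.lam ^ W.N) ^ (n + 1) • b := by
  have hμ := W.scale_pos
  have hne : ∀ m : ℕ, (σ.lam ^ W.N) ^ m ≠ 0 := fun m => (pow_pos hμ m).ne'
  obtain ⟨j, hj⟩ := hA.exists_mem_subdiv_copies hfix hF.isFirstTree ha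
  rw [interior_smul₀ (hne _), mem_smul_set_iff_inv_smul_mem₀ (hne _)] at hyK hyK'
  -- If the level of `a` is at least `n + 1`, then `a` is a piece of some $\mu^{n+1}g$ with `g` in a
  -- tile of $T_p$. As `g` meets the interior of $p$, that tile is $p$.
  rcases le_or_gt (n + 1) j with hnj | hnj
  · obtain ⟨m, rfl⟩ := Nat.exists_eq_add_of_le hnj
    have hj' := hj
    rw [Function.iterate_add_apply] at hj'
    obtain ⟨g, hg, hag⟩ := mem_subdiv_iterate_singletons.1 hj'
    have hgT := hA.subdiv_iterate_subset (hF.isFirstTree.copies_subset p) m hg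
    have hsub := hA.carrier_subset_of_mem_subdiv hag
    have hyg := (mem_smul_set_iff_inv_smul_mem₀ (hne _) _ _).1 (hsub hy)
    have hyg' := (mem_smul_set_iff_inv_smul_mem₀ (hne _) _ _).1 (hsub hy')
    have htile : A.tile g = Tile.ofProto p := by
      by_contra hcon
      refine ((Substitution.nonOverlapping_tiling hfix p).disjoint
        (Substitution.ofProto_mem_tiling p) hgT (Ne.symm hcon)).le_bot ⟨?_,
          hA.isQuasiDual.carrier_subset g hyg⟩
      rwa [PrototileSet.tileSupp_ofProto]
    have hgp : g ∈ A.edgesOf (Tile.ofProto p) := htile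
    have hfr : ((σ.lam ^ W.N) ^ (n + 1))⁻¹ • y' ∈ frontier (Pr.supp p) := by
      rw [(Pr.isCompact_supp p).isClosed.frontier_eq]
      refine ⟨?_, hyK'⟩
      have := hA.isQuasiDual.carrier_subset g hyg'
      rwa [htile, PrototileSet.tileSupp_ofProto] at this
    refine ⟨g, hgp, _, ?_, hfr, ?_, (smul_inv_smul₀ (hne _) y').symm⟩
    · obtain ⟨hhost, hg2⟩ := GeomGraph.mem_edgesOf_ofProto.1 hgp
      rw [GeomGraph.carrier_eq_range] at hyg'
      obtain ⟨s, hs⟩ := hyg'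
      refine hs ▸ GeomGraph.pt_mem_ends (hA.isQuasiDual.boundary g.1 s ?_)
      rw [← A.pt_sub g s, hs, hg2, sub_zero, hhost]
      exact hfr
    · refine Subset.trans ?_ (hA.subdiv_copies_subset hfix hF.isFirstTree p (n + 1 + m))
      rw [Function.iterate_add_apply _ (n + 1) m]
      exact subdiv_iterate_mono (singleton_subset_iff.2 hg) (n + 1)
  -- At a lower level `j`, `a` lies in an inflated copy of $F_1$, hence in the interior of a
  -- supertile of level `j + 1`. Such a supertile is either contained in that of $p$ or has interior
  -- disjoint from it, so `a` cannot cross the boundary.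
  · exfalso
    obtain ⟨m, rfl⟩ := Nat.exists_eq_add_of_le (Nat.lt_succ_iff.1 hnj)
    obtain ⟨c, ⟨t, ht, hct⟩, hac⟩ := mem_subdiv_iterate_singletons.1 hj
    have hint : ∀ z ∈ A.carrier a,
        ((σ.lam ^ W.N) ^ (j + 1))⁻¹ • z ∈ interior (Pr.tileSupp t) := by
      intro z hz
      have hzc := (mem_smul_set_iff_inv_smul_mem₀ (hne _) _ _).1
        (hA.carrier_subset_of_mem_subdiv hac hz)
      rw [PrototileSet.mem_interior_tileSupp]
      refine hF.isFirstTree.interior t.label _ hct ?_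
      rw [subCarrier, mem_smul_set_iff_inv_smul_mem₀ (inv_ne_zero hμ.ne'), inv_inv, smul_sub,
        pow_succ', mul_inv, ← smul_smul, smul_inv_smul₀ hμ.ne', GeomGraph.mem_carrier,
        sub_sub_sub_cancel_right]
      exact GeomGraph.mem_carrier.1 hzc
    have hscale : ∀ z : Plane, ((σ.lam ^ W.N) ^ (j + m + 1))⁻¹ • z =
        ((σ.lam ^ W.N) ^ m)⁻¹ • ((σ.lam ^ W.N) ^ (j + 1))⁻¹ • z := by
      intro z
      rw [smul_smul, ← mul_inv, ← pow_add, show m + (j + 1) = j + m + 1 by omega]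
    rw [hscale] at hyK hyK'
    by_cases htm : t ∈ σ.iter (W.N * m) p
    · have hsub := interior_mono (Substitution.tileSupp_subset_of_mem_iter htm)
      have := hsub (hint y' hy')
      rw [pow_mul, interior_smul₀ (hne _), mem_smul_set_iff_inv_smul_mem₀ (hne _)] at this
      exact hyK' this
    · have hdis := Substitution.disjoint_interior_of_notMem_iter hfix ht htm
      refine hdis.le_bot ⟨hint y hy, ?_⟩
      rw [pow_mul, mem_smul_set_iff_inv_smul_mem₀ (hne _)]
      exact interior_subset hyK

/-- The tiles of `T_p` outside of the supertile `ω^(N n)(p)` have fractal distance at least `c κⁿ`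
from `p`. -/
theorem exists_le_fractalDist [Fintype E] [DecidableEq E] {κ : ℝ} (hfix : σ.FixesPrototiles)
    (hPF : W.IsPerronFrobenius κ v) (hA : W.IsFractalGraph A) (hF : W.IsFractalTree A F₁ p) :
    ∃ c > 0, ∀ n, ∀ s ∈ σ.tiling p, s ∉ σ.iter (W.N * n) p →
      c * κ ^ n ≤ W.fractalDist A F₁ v p s (Tile.ofProto p) := by
  classical
  have hv : ∀ e, 0 ≤ v e := fun e => (hPF.pos e).le
  have hκ : 0 < κ := zero_lt_one.trans hPF.one_lt
  obtain ⟨c, hc, hcv⟩ : ∃ c > 0, ∀ e, c ≤ v e := by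
    cases isEmpty_or_nonempty E
    · exact ⟨1, one_pos, fun e => isEmptyElim e⟩
    · obtain ⟨e, he⟩ := Finite.exists_min v
      exact ⟨v e, hPF.pos e, he⟩
  refine ⟨c, hc, fun n s hs hsn => ?_⟩
  have hno := Substitution.nonOverlapping_tiling hfix p
  have hpT := Substitution.ofProto_mem_tiling (σ := σ) p
  obtain ⟨w, hw⟩ := (hF.isTree.connected s.pos (hF.puncture s hs) (Tile.ofProto p).pos
    (hF.puncture _ hpT)).exists_isPath
  rcases n with _ | n
  -- At level 0 there is no supertile to leave; a nontrivial path has at least one edge, of length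
  -- at least `c`.
  · have hne : s ≠ Tile.ofProto p := hsn
    have hpos : s.pos ≠ (Tile.ofProto p).pos := fun h => hne (hno.eq_of_pos_eq hs hpT h)
    obtain ⟨z, hz⟩ : ∃ z, z ∈ w.edges := by
      rcases hl : w.edges with _ | ⟨z, l⟩
      · exact absurd (SimpleGraph.Walk.edges_eq_nil.1 hl).eq hpos
      · exact ⟨z, List.mem_cons_self⟩
    obtain ⟨a, ha, rfl⟩ := GeomGraph.exists_ends_of_mem_edgeSet (w.edges_subset_edgeSet hz)
    have := hF.le_fractalDist hv (singleton_subset_iff.2 ha) (finite_singleton a) hw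
      (by rintro _ rfl; exact hz)
    rw [length_singleton] at this
    simpa using (hcv a.1).trans this
  · have hμ := W.scale_pos
    have hne : (σ.lam ^ W.N) ^ (n + 1) ≠ 0 := (pow_pos hμ _).ne'
    have h0 : (Tile.ofProto p).pos ∈ interior ((σ.lam ^ W.N) ^ (n + 1) • Pr.supp p) := by
      rw [interior_smul₀ hne]
      exact ⟨0, Pr.zero_mem_interior p, smul_zero _⟩
    have hsK : s.pos ∉ interior ((σ.lam ^ W.N) ^ (n + 1) • Pr.supp p) := by
      intro h
      rw [← pow_mul] at h
      exact (Substitution.disjoint_interior_of_notMem_iter hfix hs hsn).le_bot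
        ⟨Pr.pos_mem_interior s, interior_subset h⟩
    obtain ⟨d, hd, hdK, hdK'⟩ := w.reverse.exists_boundary_dart _ h0 hsK
    obtain ⟨a, ha, hae⟩ := GeomGraph.exists_ends_of_adj d.adj
    obtain ⟨g, hg, b, hb, hfr, hsub, hyb⟩ := hF.exists_exit hA hfix ha
      (GeomGraph.mem_carrier_of_mem_ends (hae ▸ Sym2.mem_mk_left _ _))
      (GeomGraph.mem_carrier_of_mem_ends (hae ▸ Sym2.mem_mk_right _ _)) hdK hdK'
    have hsupp : (σ.lam ^ W.N) ^ (n + 1) • b ∈ w.reverse.support :=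
      hyb ▸ w.reverse.dart_snd_mem_support_of_mem_darts hd
    have hgT : {g} ⊆ A.tilingEdges σ p := by
      rw [singleton_subset_iff]
      change A.tile g ∈ σ.tiling p
      rwa [show A.tile g = Tile.ofProto p from hg]
    -- The initial part of the path, from `p` to the exit point, already contains the whole inflated
    -- edge.
    have key := hF.le_fractalDist hv hsub (finite_subdiv_iterate (finite_singleton g) (n + 1)) hw
      (fun e he => by
        have h1 := hF.ends_mem_edges hA hfix hg hb hfr hsub (w.reverse.takeUntil _ hsupp) he
        have h2 := w.reverse.edges_takeUntil_subset_edges hsupp h1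
        rwa [SimpleGraph.Walk.edges_reverse, List.mem_reverse] at h2)
    rw [hPF.length_subdiv_iterate hA hfix hgT (finite_singleton g), length_singleton] at key
    refine le_trans ?_ key
    rw [mul_comm]
    exact mul_le_mul_of_nonneg_left (hcv _) (pow_pos hκ _).le

end RecurrentPair

end LowerBound

end FractalTiling

namespace FractalTiling

/-! ### Comparison of the distances of nearby tiles -/

section Comparison

variable {ι E : Type*} {Pr : PrototileSet ι} {σ : Substitution Pr} {A : GeomGraph ι E}
  {W : RecurrentPair σ E} {F₁ : ι → Set (E × Plane)} {v : E → ℝ} {p : ι}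

/-- Tiles at bounded distance from the supertile `ω^(N n)(p)` lie in `ω^(N (n + k))(p)`. -/
theorem RecurrentPair.exists_mem_iter_add (W : RecurrentPair σ E) (hfix : σ.FixesPrototiles)
    (p : ι) (R : ℝ) : ∃ k, ∀ n, ∀ s ∈ σ.iter (W.N * n) p, ∀ s' ∈ σ.tiling p,
      ‖s'.pos - s.pos‖ ≤ R → s' ∈ σ.iter (W.N * (n + k)) p := by
  have hμ := W.one_lt_scale
  obtain ⟨r, hr, hball⟩ := Metric.isOpen_iff.1 isOpen_interior _ (Pr.zero_mem_interior p)
  obtain ⟨R₀, hR₀⟩ := (Pr.isCompact_supp p).isBounded.exists_norm_le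
  -- Here $B(0,r)\subseteq\operatorname{supp}(p)\subseteq \overline B(0,R_0)$. With $\mu^k r>R_0+R$,
  -- the `R`-neighbourhood of level `n` stays inside the ball of radius $\mu^{n+k}r$ in level `n +
  -- k`.
  obtain ⟨k, hk⟩ := pow_unbounded_of_one_lt ((R₀ + R) / r) hμ
  rw [div_lt_iff₀ hr] at hk
  refine ⟨k, fun n s hs s' hs' hdist => ?_⟩
  have hpos : ∀ m, 0 < (σ.lam ^ W.N) ^ m := fun m => W.scale_pow_pos m
  have hR : 0 ≤ R := (norm_nonneg _).trans hdist
  have h1 : ‖s.pos‖ ≤ (σ.lam ^ W.N) ^ n * R₀ := by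
    have := Substitution.tileSupp_subset_of_mem_iter hs (interior_subset (Pr.pos_mem_interior s))
    rw [pow_mul] at this
    obtain ⟨y, hy, hys⟩ := this
    rw [← hys]
    simp only [norm_smul, Real.norm_of_nonneg (hpos n).le]
    exact mul_le_mul_of_nonneg_left (hR₀ y hy) (hpos n).le
  have h2 : ‖s'.pos‖ < (σ.lam ^ W.N) ^ (n + k) * r := by
    calc ‖s'.pos‖ = ‖s.pos + (s'.pos - s.pos)‖ := by rw [add_sub_cancel]
      _ ≤ (σ.lam ^ W.N) ^ n * R₀ + R := (norm_add_le _ _).trans (add_le_add h1 hdist)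
      _ ≤ (σ.lam ^ W.N) ^ n * (R₀ + R) := by
        rw [mul_add]
        exact add_le_add le_rfl (le_mul_of_one_le_left hR (one_le_pow₀ hμ.le))
      _ < (σ.lam ^ W.N) ^ n * ((σ.lam ^ W.N) ^ k * r) := mul_lt_mul_of_pos_left hk (hpos n)
      _ = (σ.lam ^ W.N) ^ (n + k) * r := by rw [pow_add, mul_assoc]
  by_contra hcon
  refine (Substitution.disjoint_interior_of_notMem_iter hfix hs' hcon).le_bot
    ⟨Pr.pos_mem_interior s', ?_⟩
  rw [pow_mul, mem_smul_set_iff_inv_smul_mem₀ (hpos _).ne']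
  refine interior_subset (hball ?_)
  rw [mem_ball_zero_iff, norm_smul, norm_inv, Real.norm_of_nonneg (hpos _).le,
    inv_mul_lt_iff₀ (hpos _)]
  exact h2

/-- If $n+1$ is the first level containing `s`, then $d(s,p)\ge c\kappa^n$, while `s'` lies in level
$n+1+k$, so $d(s',p)\le C\kappa^{n+1+k}$. The ratio is bounded by $(C/c)\kappa^{k+1}$, independently
of $n$; exchange the two tiles for the other sign. -/
theorem RecurrentPair.exists_log_sub_le [Finite ι] [Fintype E] [DecidableEq E] {κ : ℝ}
    (hfix : σ.FixesPrototiles) (hPF : W.IsPerronFrobenius κ v) (hA : W.IsFractalGraph A)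
    (hF : W.IsFractalTree A F₁ p) (R : ℝ) : ∃ M : ℝ, ∀ s s' : σ.OtherTiles p,
      ‖s'.1.pos - s.1.pos‖ ≤ R →
      |Real.log (W.fractalDist A F₁ v p s.1 (Tile.ofProto p)) -
        Real.log (W.fractalDist A F₁ v p s'.1 (Tile.ofProto p))| ≤ M := by
  obtain ⟨C, hC, hupper⟩ := exists_fractalDist_le hfix hPF hA hF
  obtain ⟨c, hc, hlower⟩ := exists_le_fractalDist hfix hPF hA hF
  obtain ⟨k, hk⟩ := W.exists_mem_iter_add hfix p R
  have hκ : 0 < κ := zero_lt_one.trans hPF.one_lt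
  have hpos : ∀ s : σ.OtherTiles p, 0 < W.fractalDist A F₁ v p s.1 (Tile.ofProto p) := by
    intro s
    have := hlower 0 s.1 s.2.1 s.2.2
    rw [pow_zero, mul_one] at this
    exact hc.trans_le this
  have hM : 0 < C / c * κ ^ (k + 1) := by positivity
  have key : ∀ s s' : σ.OtherTiles p, ‖s'.1.pos - s.1.pos‖ ≤ R →
      Real.log (W.fractalDist A F₁ v p s'.1 (Tile.ofProto p)) -
        Real.log (W.fractalDist A F₁ v p s.1 (Tile.ofProto p)) ≤
          Real.log (C / c * κ ^ (k + 1)) := by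
    classical
    intro s s' hss
    have hex := (Substitution.mem_tiling_iff hfix W.N_pos).1 s.2.1
    -- The first level is not 0, because level 0 contains only the excluded tile `p`.
    obtain ⟨n, hn⟩ : ∃ n, Nat.find hex = n + 1 := by
      refine Nat.exists_eq_succ_of_ne_zero fun h0 => s.2.2 ?_
      have := Nat.find_spec hex
      rw [h0] at this
      exact this
    have hin := Nat.find_spec hex
    have hout := Nat.find_min hex (m := n) (by omega)
    rw [hn] at hin
    have h1 := hlower n s.1 s.2.1 hout
    have h2 := hupper _ s'.1 (hk _ _ hin s'.1 s'.2.1 hss)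
    rw [sub_le_iff_le_add, ← Real.log_mul hM.ne' (hpos s).ne']
    refine Real.log_le_log (hpos s') (h2.trans ?_)
    calc C * κ ^ (n + 1 + k) = C / c * κ ^ (k + 1) * (c * κ ^ n) := by
          field_simp
          ring
      _ ≤ _ := mul_le_mul_of_nonneg_left h1 hM.le
  refine ⟨Real.log (C / c * κ ^ (k + 1)), fun s s' hss => abs_sub_le_iff.2 ⟨?_, key s s' hss⟩⟩
  exact key s' s (by rwa [norm_sub_rev])

end Comparison

/-! ### Operators given by partial injections -/

/-- A bounded matrix with at most one nonzero entry in each row and in each column defines a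
bounded operator. -/
theorem exists_clm_of_partialInjection {I : Type*} (f : I → I → ℂ) (C : ℝ)
    (hrow : ∀ s s' s'', f s s' ≠ 0 → f s s'' ≠ 0 → s' = s'')
    (hcol : ∀ s s' s'', f s s'' ≠ 0 → f s' s'' ≠ 0 → s = s') (hC : ∀ s s', ‖f s s'‖ ≤ C) :
    ∃ B : lp (fun _ : I => ℂ) 2 →L[ℂ] lp (fun _ : I => ℂ) 2,
      ∀ ξ s, HasSum (fun s' => f s s' * ξ s') (B ξ s) := by
  classical
  -- `c s` is the column of the only possible nonzero entry in row `s`; for a zero row the choice is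
  -- irrelevant.
  have hex : ∀ s, ∃ c, ∀ s', f s s' ≠ 0 → s' = c := by
    intro s
    by_cases h : ∃ c, f s c ≠ 0
    · obtain ⟨c, hc⟩ := h
      exact ⟨c, fun s' hs' => hrow s s' c hs' hc⟩
    · exact ⟨s, fun s' hs' => absurd ⟨s', hs'⟩ h⟩
  choose c hc using hex
  have hbound : ∀ (ξ : lp (fun _ : I => ℂ) 2) (F : Finset I),
      ∑ s ∈ F, ‖f s (c s) * ξ (c s)‖ ^ (2 : ℝ≥0∞).toReal ≤
        (|C| * ‖ξ‖) ^ (2 : ℝ≥0∞).toReal := by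
    intro ξ F
    have h2 : 0 < (2 : ℝ≥0∞).toReal := by norm_num
    -- On nonzero rows `c` is injective, so each coordinate of `ξ` is used at most once and the sum
    -- is controlled by `‖ξ‖`.
    have hinj : Set.InjOn c (F.filter fun s => f s (c s) ≠ 0) := by
      intro s hs s' hs' h
      have hs := (Finset.mem_filter.1 hs).2
      have hs' := (Finset.mem_filter.1 hs').2
      exact hcol s s' (c s) hs (h ▸ hs')
    calc ∑ s ∈ F, ‖f s (c s) * ξ (c s)‖ ^ (2 : ℝ≥0∞).toReal
        = ∑ s ∈ F.filter (fun s => f s (c s) ≠ 0),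
            ‖f s (c s) * ξ (c s)‖ ^ (2 : ℝ≥0∞).toReal := by
          refine (Finset.sum_filter_of_ne (p := fun s => f s (c s) ≠ 0) fun s _ hs h0 => hs ?_).symm
          rw [h0, zero_mul, norm_zero, Real.zero_rpow h2.ne']
      _ ≤ ∑ s ∈ F.filter (fun s => f s (c s) ≠ 0),
            |C| ^ (2 : ℝ≥0∞).toReal * ‖ξ (c s)‖ ^ (2 : ℝ≥0∞).toReal := by
          refine Finset.sum_le_sum fun s _ => ?_
          rw [← Real.mul_rpow (abs_nonneg _) (norm_nonneg _), norm_mul]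
          exact Real.rpow_le_rpow (by positivity) (mul_le_mul_of_nonneg_right
            ((hC _ _).trans (le_abs_self C)) (norm_nonneg _)) h2.le
      _ = |C| ^ (2 : ℝ≥0∞).toReal *
            ∑ s ∈ (F.filter fun s => f s (c s) ≠ 0).image c,
              ‖ξ s‖ ^ (2 : ℝ≥0∞).toReal := by
          rw [Finset.sum_image hinj, Finset.mul_sum]
      _ ≤ |C| ^ (2 : ℝ≥0∞).toReal * ‖ξ‖ ^ (2 : ℝ≥0∞).toReal :=
          mul_le_mul_of_nonneg_left (lp.sum_rpow_le_norm_rpow h2 ξ _)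
            (Real.rpow_nonneg (abs_nonneg _) _)
      _ = _ := (Real.mul_rpow (abs_nonneg _) (norm_nonneg _)).symm
  let L : lp (fun _ : I => ℂ) 2 →ₗ[ℂ] lp (fun _ : I => ℂ) 2 :=
    { toFun := fun ξ => ⟨fun s => f s (c s) * ξ (c s), memℓp_gen' (hbound ξ)⟩
      map_add' := fun ξ η => by
        ext s
        exact mul_add _ _ _
      map_smul' := fun a ξ => by
        ext s
        exact mul_left_comm _ _ _ }
  refine ⟨L.mkContinuous |C| fun ξ => lp.norm_le_of_forall_sum_le (by norm_num)
    (mul_nonneg (abs_nonneg _) (norm_nonneg _)) (hbound ξ), fun ξ s => ?_⟩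
  refine hasSum_single (c s) fun s' hs' => ?_
  by_contra h
  exact hs' (hc s s' (left_ne_zero_of_mul h))

/-! ### The matrix entries of $\pi_p(e(P,t,t'))$ -/

section Representation

variable {ι : Type*} {Pr : PrototileSet ι} {σ : Substitution Pr}

/-- A nonzero entry says that $T_p-x(s')$ and $T_p-x(s)-(x(t')-x(t))$ coincide; the difference of
the two translations is a period of $T_p$, hence 0. So `s` and `s'` determine each other. -/
theorem Substitution.pos_sub_pos_of_e_ne_zero (hnonper : σ.IsNonperiodic) {p : ι}
    {P : Set (Tile ι)} {t t' s s' : Tile ι}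
    (h : σ.e P t t' (shiftSet (σ.tiling p) (-s.pos)) (shiftSet (σ.tiling p) (-s'.pos)) ≠ 0) :
    s'.pos - s.pos = t'.pos - t.pos := by
  unfold Substitution.e at h
  split_ifs at h with he
  · have h1 := congrArg (fun T => shiftSet T s'.pos) he.2.2
    simp only [shiftSet_shiftSet, neg_add_cancel, shiftSet_zero] at h1
    have h2 := hnonper p _ h1.symm
    rw [← sub_eq_zero, ← h2]
    abel
  · exact absurd rfl h

theorem Substitution.norm_e_le_one (P : Set (Tile ι)) (t t' : Tile ι) (T T' : Set (Tile ι)) :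
    ‖σ.e P t t' T T'‖ ≤ 1 := by
  rw [Substitution.e]
  split_ifs <;> simp

end Representation

end FractalTiling

/-! ### The commutator -/

open FractalTiling
theorem mainTheorem3 {ι E : Type*} [Fintype ι] [DecidableEq ι] [Fintype E] [DecidableEq E]
    {Pr : PrototileSet ι} (σ : Substitution Pr)
    (hprim : σ.IsPrimitive) (hfix : σ.FixesPrototiles) (hnonper : σ.IsNonperiodic)
    (W : RecurrentPair σ E)
    (κ : ℝ) (v : E → ℝ) (hPF : W.IsPerronFrobenius κ v)
    (A : GeomGraph ι E) (hA : W.IsFractalGraph A)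
    (p : ι) (F₁ : ι → Set (E × Plane)) (hF : W.IsFractalTree A F₁ p)
    (T : Set (Tile ι)) (hT : T ∈ σ.discreteHull)
    (P : Set (Tile ι)) (hPT : P ⊆ T) (hP : Pr.IsPatch P)
    (t t' : Tile ι) (ht : t ∈ P) (ht' : t' ∈ P) :
    ∃ π B : σ.H p →L[ℂ] σ.H p,
      σ.IsRepr p (σ.e P t t') π ∧
      ∀ ξ : (W.D A F₁ v p).domain,
        ∃ h : π ξ ∈ (W.D A F₁ v p).domain,
          (W.D A F₁ v p) ⟨π ξ, h⟩ - π ((W.D A F₁ v p) ξ) = B ξ := by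
  have hno := Substitution.nonOverlapping_tiling hfix p
  let g : σ.OtherTiles p → ℝ := fun s =>
    Real.log (W.fractalDist A F₁ v p s.1 (Tile.ofProto p))
  let f : σ.OtherTiles p → σ.OtherTiles p → ℂ := fun s s' =>
    σ.e P t t' (shiftSet (σ.tiling p) (-s.1.pos)) (shiftSet (σ.tiling p) (-s'.1.pos))
  have hf : ∀ s s', f s s' ≠ 0 → s'.1.pos - s.1.pos = t'.pos - t.pos := fun s s' h =>
    Substitution.pos_sub_pos_of_e_ne_zero hnonper h
  have hrow : ∀ s s' s'', f s s' ≠ 0 → f s s'' ≠ 0 → s' = s'' := fun s s' s'' h h' =>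
    Subtype.ext (hno.eq_of_pos_eq s'.2.1 s''.2.1
      (sub_left_injective ((hf s s' h).trans (hf s s'' h').symm)))
  have hcol : ∀ s s' s'', f s s'' ≠ 0 → f s' s'' ≠ 0 → s = s' := fun s s' s'' h h' =>
    Subtype.ext (hno.eq_of_pos_eq s.2.1 s'.2.1
      (sub_right_injective ((hf s s'' h).trans (hf s' s'' h').symm)))
  obtain ⟨π, hπ⟩ := exists_clm_of_partialInjection f 1 hrow hcol
    fun s s' => Substitution.norm_e_le_one _ _ _ _ _
  obtain ⟨M, hM⟩ := RecurrentPair.exists_log_sub_le hfix hPF hA hF ‖t'.pos - t.pos‖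
  -- The commutator has the entries $(g(s)-g(s'))f(s,s')$. They are bounded because `f` is nonzero
  -- only between tiles at distance $\|x(t')-x(t)\|$.
  obtain ⟨B, hB⟩ := exists_clm_of_partialInjection
    (fun s s' => ((g s - g s' : ℝ) : ℂ) * f s s') |M|
    (fun s s' s'' h h' => hrow s s' s'' (right_ne_zero_of_mul h) (right_ne_zero_of_mul h'))
    (fun s s' s'' h h' => hcol s s' s'' (right_ne_zero_of_mul h) (right_ne_zero_of_mul h'))
    (fun s s' => by
      by_cases h : f s s' = 0
      · rw [h, mul_zero, norm_zero]
        exact abs_nonneg M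
      · rw [norm_mul, Complex.norm_real, Real.norm_eq_abs, ← mul_one |M|]
        exact mul_le_mul ((hM s s' (hf s s' h ▸ le_rfl)).trans (le_abs_self M))
          (Substitution.norm_e_le_one _ _ _ _ _) (norm_nonneg _) (abs_nonneg _))
  refine ⟨π, B, hπ, fun ξ => ?_⟩
  -- This identity gives both claims: its right side is in $\ell^2$, so $\pi\xi$ lies in the domain
  -- of $D_p$, and rearranged it is the commutator formula.
  have key : ∀ s, (g s : ℂ) * π ξ s = B ξ s + π ((W.D A F₁ v p) ξ) s := by
    intro s
    refine ((hπ ξ s).mul_left (g s : ℂ)).unique ?_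
    refine ((hB ξ s).add (hπ ((W.D A F₁ v p) ξ) s)).congr_fun ?_
    intro s'
    change _ = ((g s - g s' : ℝ) : ℂ) * f s s' * (ξ : σ.H p) s' +
      f s s' * ((g s' : ℂ) * (ξ : σ.H p) s')
    push_cast
    ring
  refine ⟨?_, ?_⟩
  · change Memℓp (fun s => (g s : ℂ) * π ξ s) 2
    rw [funext key]
    exact (B ξ + π ((W.D A F₁ v p) ξ)).2
  · ext s
    change (g s : ℂ) * π ξ s - π ((W.D A F₁ v p) ξ) s = B ξ s
    rw [key, add_sub_cancel_right]
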